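/- Let $K$ be a non-archimedean local field (for example a $p$-adic field, $[K:\mathbb{Q}_p]<\infty$), with valuation ring $\mathcal{O}_K$, maximal ideal $\mathcal{P}_K$, residue field of cardinality $q$, normalized valuation $v_K$ and absolute value $|z|_K=q^{-v_K(z)}$; put $\|(z_1,\dots,z_l)\|_K=\max_i|z_i|_K$ on $K^l$, and let $|dx|$ be the Haar measure on $K^n$ for which $\mathcal{O}_K^n$ has measure one. Let $l\ge 1$, let $N_1,\dots,N_l\in\mathbb{N}^n\setminus\{0\}$, $N=(N_1,\dots,N_l)$, $v\in\mathbb{N}^n$, $e_0\in\mathbb{N}$, and let $c_1,\dots,c_l\in\mathcal{O}_K$ be non-zero. For $M\in\mathbb{N}^n$ write $x^M=\prod_j x_j^{M_j}$, and put $$I_{(N,v)}(s)=\int_{(\mathcal{P}_K^{e_0})^n}\left\|\left(c_1x^{N_1},\dots,c_lx^{N_l}\right)\right\|_K^{s}\,|x^v|_K\,|dx|,\qquad \operatorname{Re}(s)>0 .$$ Let $\Gamma(N)\subseteq\mathbb{R}^n$ be the Newton polyhedron of $N$, i.e. the convex hull of $\bigcup_{i}(N_i+\mathbb{R}_{\ge0}^n)$.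 For $a\in\mathbb{R}_{\ge0}^n$ put $m(a)=\inf_{x\in\Gamma(N)}\langle a,x\rangle$ and $\sigma(a)=\sum_j a_j$. For a facet $\gamma$ of $\Gamma(N)$ (a face of dimension $n-1$) let $a(\gamma)$ be the unique vector perpendicular to $\gamma$ whose components are non-negative integers with greatest common divisor one, so that $\gamma=\{x\in\Gamma(N):\langle a(\gamma),x\rangle=m(a(\gamma))\}$. Then the integral $I_{(N,v)}(s)$ converges absolutely for $\operatorname{Re}(s)>0$ and is there equal to a rational function of $q^{-s}$, which gives its meromorphic continuation to $\mathbb{C}$. Every pole of this continuation is of the form $$s=-\frac{\sigma(a(\gamma))+\langle v,a(\gamma)\rangle}{m(a(\gamma))}+\frac{2\pi\sqrt{-1}\,k}{m(a(\gamma))\log q},\qquad k\in\mathbb{Z},$$ for some facet $\gamma$ of $\Gamma(N)$ with $m(a(\gamma))\neq0$. -/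

import Mathlib

open MeasureTheory ValuativeRel

namespace MonomialIntegral

noncomputable section

section LocalField

variable (K : Type*) [Field K] [ValuativeRel K] [TopologicalSpace K]
  [IsNonarchimedeanLocalField K]

/-- The cardinality `q` of the residue field of `K`. -/
def resCard : ℕ := Nat.card 𝓀[K]

variable {K}

/-- The normalized additive valuation `v(z)` of a nonzero `z : K`, with `v(π) = 1` for a
uniformizer `π` (the value at `z = 0` is not used). Mathlib's canonical valuation is
multiplicative, so a uniformizer goes to `exp (-1)` in `ℤᵐ⁰`; hence the sign. -/
def ord (z : K) : ℤ :=
  -WithZero.log (IsNonarchimedeanLocalField.valueGroupWithZeroIsoInt K (valuation K z))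

open Classical in
/-- The normalized absolute value `|z|_K = q ^ (-v(z))`, with `|0|_K = 0`. -/
def absK (z : K) : ℝ := if z = 0 then 0 else (resCard K : ℝ) ^ (-ord z)

/-- The max norm `‖x‖_K = max_i |x_i|_K` on `K ^ l`. -/
def normK {l : ℕ} (x : Fin l → K) : ℝ := ⨆ i, absK (x i)

/-- The monomial `x ^ M = ∏_j x_j ^ M_j`. -/
def monom {n : ℕ} (M : Fin n → ℕ) (x : Fin n → K) : K := ∏ j, x j ^ M j

variable (K) in
/-- The polydisc `(𝒫_K ^ e₀) ^ n` in `K ^ n`, where `𝒫_K` is the maximal ideal of `𝒪_K`. -/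
def polydisc (n e₀ : ℕ) : Set (Fin n → K) :=
  {x | ∀ j, ∃ y : 𝒪[K], y ∈ 𝓂[K] ^ e₀ ∧ (y : K) = x j}

/-- The integrand `‖(c_1 x ^ N_1, …, c_l x ^ N_l)‖_K ^ s * |x ^ v|_K`. -/
def integrand {n l : ℕ} (N : Fin l → Fin n → ℕ) (v : Fin n → ℕ) (c : Fin l → 𝒪[K])
    (s : ℂ) (x : Fin n → K) : ℂ :=
  ((normK fun i => (c i : K) * monom (N i) x : ℝ) : ℂ) ^ s * ((absK (monom v x) : ℝ) : ℂ)

end LocalField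

section Newton

variable {n : ℕ}

/-- The Newton polyhedron `Γ(S)`: the convex hull of `⋃_{m ∈ S} (m + ℝ_{≥0} ^ n)`. -/
def newtonPolyhedron (S : Set (Fin n → ℕ)) : Set (Fin n → ℝ) :=
  convexHull ℝ (⋃ m ∈ S, {x | ∃ y : Fin n → ℝ, (∀ j, 0 ≤ y j) ∧ x = (fun j => (m j : ℝ)) + y})

/-- `m(a) = inf_{x ∈ Γ} ⟨a, x⟩`. -/
def supportMin (Γ : Set (Fin n → ℝ)) (a : Fin n → ℝ) : ℝ :=
  sInf ((fun x => a ⬝ᵥ x) '' Γ)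

/-- A facet of `Γ ⊆ ℝ ^ n`: a (nonempty, exposed) face of dimension `n - 1`. -/
def IsFacet (Γ γ : Set (Fin n → ℝ)) : Prop :=
  IsExposed ℝ Γ γ ∧ γ.Nonempty ∧ Module.finrank ℝ (vectorSpan ℝ γ) + 1 = n

/-- `a` is the primitive vector `a(γ)` of `γ`: its components are nonnegative integers with
greatest common divisor one, and it is perpendicular to `γ`. -/
def IsPrimitiveNormal (γ : Set (Fin n → ℝ)) (a : Fin n → ℕ) : Prop :=
  Finset.univ.gcd a = 1 ∧ ∀ x ∈ γ, ∀ y ∈ γ, (fun j => (a j : ℝ)) ⬝ᵥ (x - y) = 0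

end Newton

/-- `f` has a pole at `s`. -/
def IsPole (f : ℂ → ℂ) (s : ℂ) : Prop := MeromorphicAt f s ∧ meromorphicOrderAt f s < 0

end

end MonomialIntegral

/-!
Up to a null set the polydisc is the disjoint union of the shells on which every `ord (x j) = k j`
is prescribed, and there the integrand is constant. Splitting the exponents `k` according to the
first index `i` minimizing `ord (c i) + ⟨N i, k⟩` turns the integral into a finite sum of generating
series of the lattice points of rational polyhedra. The generating series of such a polyhedron is a
polynomial divided by the product of the `1 - w ^ a` over the primitive generators `a` of the
extremal rays of its recession cone, which here is the cone of those `a ≥ 0` for which `N i`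
minimizes `⟨a, ·⟩` on the Newton polyhedron. An extremal ray of that cone is orthogonal to a facet,
so every factor of the denominator belongs to a facet, and a pole solves `w ^ a = 1` for one of
them.
-/

namespace MonomialIntegral

section GeneratingSeries

/-- The monomial `∏ j, w j ^ k j` with exponent vector `k`, in any commutative monoid. -/
def mpow {ι M : Type*} [Fintype ι] [CommMonoid M] (w : ι → M) (k : ι → ℕ) : M :=
  ∏ j, w j ^ k j

section Monoid

variable {ι M : Type*} [Fintype ι] [CommMonoid M]

lemma mpow_add (w : ι → M) (k k' : ι → ℕ) : mpow w (k + k') = mpow w k * mpow w k' := by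
  simp [mpow, pow_add, Finset.prod_mul_distrib]

lemma mpow_sum_smul {κ : Type*} [Fintype κ] (w : ι → M) (a : κ → ι → ℕ) (c : κ → ℕ) :
    mpow w (∑ r, c r • a r) = mpow (fun r => mpow w (a r)) c := by
  simp only [mpow, Finset.sum_apply, Pi.smul_apply, smul_eq_mul, ← Finset.prod_pow_eq_pow_sum,
    ← Finset.prod_pow]
  rw [Finset.prod_comm]
  simp only [← pow_mul, mul_comm]

lemma map_mpow {M' F : Type*} [CommMonoid M'] [FunLike F M M'] [MonoidHomClass F M M']
    (f : F) (w : ι → M) (k : ι → ℕ) : f (mpow w k) = mpow (f ∘ w) k := by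
  simp [mpow, map_prod]

lemma mpow_cons {m : ℕ} (w : Fin (m + 1) → M) (t : ℕ) (k : Fin m → ℕ) :
    mpow w (Fin.cons t k) = w 0 ^ t * mpow (Fin.tail w) k := by
  simp [mpow, Fin.prod_univ_succ, Fin.tail]

end Monoid

variable {𝕜 : Type*} [NormedField 𝕜]

lemma norm_mpow_lt_one {ι : Type*} [Fintype ι] {w : ι → 𝕜} (hw : ∀ j, ‖w j‖ < 1) {a : ι → ℕ}
    (ha : a ≠ 0) : ‖mpow w a‖ < 1 := by
  classical
  obtain ⟨j, hj⟩ := Function.ne_iff.1 ha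
  have hj1 : ‖w j ^ a j‖ < 1 := by
    rw [norm_pow]
    exact pow_lt_one₀ (norm_nonneg _) (hw j) hj
  rw [mpow, ← Finset.mul_prod_erase _ _ (Finset.mem_univ j), norm_mul]
  refine mul_lt_one_of_nonneg_of_lt_one_left (norm_nonneg _) hj1 ?_
  rw [norm_prod]
  refine Finset.prod_le_one (fun _ _ => norm_nonneg _) fun i _ => ?_
  rw [norm_pow]
  exact pow_le_one₀ (norm_nonneg _) (hw i).le

lemma summable_mpow {m : ℕ} {w : Fin m → 𝕜} (hw : ∀ j, ‖w j‖ < 1) :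
    Summable fun k : Fin m → ℕ => ‖mpow w k‖ := by
  induction m with
  | zero => exact (hasSum_fintype _).summable
  | succ m ih =>
    have h := (summable_geometric_of_lt_one (norm_nonneg _) (hw 0)).mul_of_nonneg
      (ih fun j => hw j.succ) (fun _ => by positivity) fun _ => by positivity
    rw [← (Fin.consEquiv fun _ : Fin (m + 1) => ℕ).summable_iff]
    refine h.congr fun x => ?_
    simp [Fin.consEquiv, mpow_cons, Fin.tail_def]

lemma one_sub_mul_tsum_pow_mul {x : 𝕜} (hx : ‖x‖ < 1) {f : ℕ → 𝕜} {B : ℕ}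
    (hf : ∀ t, B ≤ t → f t = f B) :
    (1 - x) * ∑' t, x ^ t * f t = (1 - x) * ∑ t ∈ Finset.range B, x ^ t * f t + x ^ B * f B := by
  have htail (t : ℕ) : x ^ (t + B) * f (t + B) = x ^ t * (x ^ B * f B) := by
    rw [hf _ (Nat.le_add_left B t), pow_add, mul_assoc]
  have hgeom := (hasSum_geometric_of_norm_lt_one hx).mul_right (x ^ B * f B)
  have hsum : Summable fun t => x ^ t * f t :=
    (summable_nat_add_iff B).1 (by simpa only [htail] using hgeom.summable)
  have hx1 : 1 - x ≠ 0 := sub_ne_zero.2 fun h => by simp [← h] at hx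
  rw [← hsum.sum_add_tsum_nat_add B, mul_add]
  simp only [htail, hgeom.tsum_eq, mul_inv_cancel_left₀ hx1]

variable [CompleteSpace 𝕜]

lemma tsum_mpow_cons {m : ℕ} {w : Fin (m + 1) → 𝕜} (hw : ∀ j, ‖w j‖ < 1)
    (S : Set (Fin (m + 1) → ℕ)) :
    ∑' k : S, mpow w k =
      ∑' t : ℕ, w 0 ^ t * ∑' k : {k | Fin.cons t k ∈ S}, mpow (Fin.tail w) k := by
  have hS : Summable (S.indicator (mpow w)) := (summable_mpow hw).of_norm.indicator S
  have hS' := (Fin.consEquiv fun _ : Fin (m + 1) => ℕ).summable_iff.2 hS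
  rw [tsum_subtype, ← (Fin.consEquiv fun _ : Fin (m + 1) => ℕ).tsum_eq]
  refine hS'.tsum_prod.trans ?_
  refine tsum_congr fun t => ?_
  rw [tsum_subtype, ← tsum_mul_left]
  refine tsum_congr fun k => ?_
  by_cases hk : Fin.cons t k ∈ S <;> simp [Fin.consEquiv, mpow_cons, Set.indicator, hk]

lemma exists_polynomial_tsum_mpow_of_mem_iff_inf {m : ℕ} {S : Set (Fin m → ℕ)} {B : ℕ}
    (hS : ∀ x, x ∈ S ↔ (x ⊓ fun _ => B) ∈ S) :
    ∃ p : MvPolynomial (Fin m) ℤ, ∀ w : Fin m → 𝕜, (∀ j, ‖w j‖ < 1) →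
      (∑' k : S, mpow w k) * ∏ j, (1 - w j) = MvPolynomial.aeval w p := by
  induction m with
  | zero =>
    rcases S.eq_empty_or_nonempty with rfl | hne
    · exact ⟨0, by simp⟩
    · exact ⟨1, by simp [Subsingleton.eq_univ_of_nonempty hne, mpow]⟩
  | succ m ih =>
    have hmem (t : ℕ) (x : Fin m → ℕ) : (Fin.cons t x : Fin (m + 1) → ℕ) ∈ S ↔
        (Fin.cons (min t B) (x ⊓ fun _ => B) : Fin (m + 1) → ℕ) ∈ S := by
      rw [hS]
      refine iff_of_eq (congrArg (· ∈ S) (funext fun j => ?_))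
      cases j using Fin.cases <;> simp
    choose p hp using fun t => ih (S := {x | Fin.cons t x ∈ S}) fun x => by
      rw [Set.mem_ofPred_eq, Set.mem_ofPred_eq, hmem, hmem t, inf_assoc, inf_idem]
    refine ⟨(1 - .X 0) * ∑ t ∈ Finset.range B, .X 0 ^ t * (p t).rename Fin.succ
      + .X 0 ^ B * (p B).rename Fin.succ, fun w hw => ?_⟩
    have hstable (t : ℕ) (ht : B ≤ t) : {k : Fin m → ℕ | (Fin.cons t k : Fin (m + 1) → ℕ) ∈ S} =
        {k | Fin.cons B k ∈ S} := Set.ext fun x => by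
      rw [Set.mem_ofPred_eq, Set.mem_ofPred_eq, hmem, hmem B, min_eq_right ht, min_self]
    rw [tsum_mpow_cons hw, Fin.prod_univ_succ, ← mul_assoc, mul_comm _ (1 - w 0),
      one_sub_mul_tsum_pow_mul (hw 0) fun t ht => by rw [hstable t ht]]
    have hp' (t : ℕ) : MvPolynomial.aeval w ((p t).rename Fin.succ) =
        (∑' k : {k | Fin.cons t k ∈ S}, mpow (Fin.tail w) k) * ∏ j : Fin m, (1 - w j.succ) :=
      (MvPolynomial.aeval_rename ..).trans (hp t (Fin.tail w) fun j => hw j.succ).symm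
    simp only [map_add, map_mul, map_sub, map_one, map_sum, map_pow, MvPolynomial.aeval_X, hp',
      add_mul, mul_assoc, Finset.sum_mul]

lemma exists_mem_iff_inf_mem {ι : Type*} [Finite ι] {L : Set (ι → ℕ)} (hL : IsLowerSet L) :
    ∃ B : ℕ, ∀ x, x ∈ L ↔ (x ⊓ fun _ => B) ∈ L := by
  have := Fintype.ofFinite ι
  have hfin : {x | Minimal (· ∈ Lᶜ) x}.Finite :=
    WellQuasiOrderedLE.finite_of_isAntichain (setOfPred_minimal_antichain _)
  obtain ⟨b, hb⟩ := hfin.bddAbove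
  refine ⟨Finset.univ.sup b, fun x => ⟨fun hx => hL inf_le_left hx, fun hx => ?_⟩⟩
  by_contra hxL
  obtain ⟨y, hyx, hy⟩ := exists_minimal_le_of_wellFoundedLT (· ∈ Lᶜ) x hxL
  exact hy.1 (hL (le_inf hyx fun j => (hb hy j).trans (Finset.le_sup (Finset.mem_univ j))) hx)

/-- The exponents `c` for which the representation `e + ∑ r, c r • a r` of an element of
`E + closure (range a)` is the lexicographically least one. -/
def leastExponents {ι : Type*} {m : ℕ} (E : Set (ι → ℕ)) (a : Fin m → ι → ℕ) (e : ι → ℕ) :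
    Set (Fin m → ℕ) :=
  {c | ∀ e' ∈ E, ∀ c', e' + ∑ r, c' r • a r = e + ∑ r, c r • a r → toLex c ≤ toLex c'}

section leastExponents

variable {ι : Type*} {m : ℕ} {E : Set (ι → ℕ)} {a : Fin m → ι → ℕ}

lemma isLowerSet_leastExponents (e : ι → ℕ) : IsLowerSet (leastExponents E a e) := by
  intro c d hdc hc e' he' d' h
  obtain ⟨f, rfl⟩ := exists_add_of_le hdc
  refine le_of_add_le_add_right (a := toLex f) (hc e' he' (d' + f) ?_)
  simp only [Pi.add_apply, add_smul, Finset.sum_add_distrib, ← add_assoc, h]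

lemma eq_and_eq_of_mem_leastExponents {e e' : ι → ℕ} (he : e ∈ E) (he' : e' ∈ E)
    {c c' : Fin m → ℕ} (hc : c ∈ leastExponents E a e) (hc' : c' ∈ leastExponents E a e')
    (h : e + ∑ r, c r • a r = e' + ∑ r, c' r • a r) : e = e' ∧ c = c' := by
  obtain rfl : c = c' := toLex.injective ((hc e' he' c' h.symm).antisymm (hc' e he c h))
  exact ⟨add_right_cancel h, rfl⟩

lemma pairwiseDisjoint_image_leastExponents :
    E.PairwiseDisjoint fun e => (fun c => e + ∑ r, c r • a r) '' leastExponents E a e := by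
  intro e he e' he' hne
  refine Set.disjoint_left.2 ?_
  rintro _ ⟨c, hc, rfl⟩ ⟨c', hc', h⟩
  exact hne (eq_and_eq_of_mem_leastExponents he he' hc hc' h.symm).1

open scoped Pointwise in
lemma biUnion_image_leastExponents :
    ⋃ e ∈ E, (fun c => e + ∑ r, c r • a r) '' leastExponents E a e =
      E + (AddSubmonoid.closure (Set.range a) : Set (ι → ℕ)) := by
  ext k
  simp only [Set.mem_iUnion, Set.mem_image, Set.mem_add, SetLike.mem_coe,
    AddSubmonoid.mem_closure_range_iff_of_fintype, exists_prop]
  constructor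
  · rintro ⟨e, he, c, -, rfl⟩
    exact ⟨e, he, _, ⟨c, rfl⟩, rfl⟩
  · rintro ⟨e₀, he₀, _, ⟨c₀, rfl⟩, hk⟩
    obtain ⟨c, ⟨e, he, hc⟩, hmin⟩ := WellFounded.has_min
      (wellFounded_lt (α := Lex (Fin m → ℕ)))
      {c | ∃ e ∈ E, e + ∑ r, ofLex c r • a r = k} ⟨toLex c₀, e₀, he₀, hk⟩
    exact ⟨e, he, ofLex c, fun e' he' c' h => le_of_not_gt (hmin _ ⟨e', he', h.trans hc⟩), hc⟩

end leastExponents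

open scoped Pointwise in
theorem exists_polynomial_tsum_mpow_add_closure {m n : ℕ}
    {E : Set (Fin n → ℕ)} (hE : E.Finite) {a : Fin m → Fin n → ℕ} (ha : ∀ r, a r ≠ 0) :
    ∃ p : MvPolynomial (Fin n) ℤ, ∀ w : Fin n → 𝕜, (∀ j, ‖w j‖ < 1) →
      (∑' k : ↑(E + (AddSubmonoid.closure (Set.range a) : Set (Fin n → ℕ))), mpow w k) *
        ∏ r, (1 - mpow w (a r)) = MvPolynomial.aeval w p := by
  choose p hp using fun e =>
    (exists_mem_iff_inf_mem (isLowerSet_leastExponents (E := E) (a := a) e)).elim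
      fun _ hB => exists_polynomial_tsum_mpow_of_mem_iff_inf (𝕜 := 𝕜) hB
  lift E to Finset (Fin n → ℕ) using hE
  refine ⟨∑ e ∈ E, mpow .X e * MvPolynomial.aeval (fun r => mpow .X (a r)) (p e), fun w hw => ?_⟩
  have hX (k : Fin n → ℕ) : MvPolynomial.aeval w (mpow (.X : Fin n → MvPolynomial (Fin n) ℤ) k) =
      mpow w k := by
    rw [map_mpow]
    exact congrArg (mpow · k) (funext fun j => MvPolynomial.aeval_X w j)
  have hclass (e : Fin n → ℕ) (he : e ∈ E) :
      ∑' k : (fun c => e + ∑ r, c r • a r) '' leastExponents E a e, mpow w k =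
        mpow w e * ∑' c : leastExponents E a e, mpow (fun r => mpow w (a r)) c := by
    rw [tsum_image (mpow w) fun c hc c' hc' h =>
      (eq_and_eq_of_mem_leastExponents (E := (E : Set (Fin n → ℕ))) he he hc hc' h).2,
      ← tsum_mul_left]
    simp only [mpow_add, mpow_sum_smul]
  rw [← biUnion_image_leastExponents, Finset.set_biUnion_coe,
    Summable.tsum_finset_bUnion_disjoint pairwiseDisjoint_image_leastExponents
      fun _ _ => (summable_mpow hw).of_norm.subtype _, Finset.sum_mul, map_sum]
  refine Finset.sum_congr rfl fun e he => ?_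
  rw [hclass e he, mul_assoc, hp e _ fun r => norm_mpow_lt_one hw (ha r), map_mul, hX,
    MvPolynomial.comp_aeval_apply]
  simp only [hX]

end GeneratingSeries
section ExtremalRays

variable {𝕜 E κ : Type*} [Field 𝕜] [LinearOrder 𝕜] [IsStrictOrderedRing 𝕜] [AddCommGroup E]
  [Module 𝕜 E]

/-- `x` spans an extremal ray of the polyhedral cone `{x | ∀ i, 0 ≤ ℓ i x}`: it is a nonzero
element of the cone, determined up to scaling by the inequalities that are equalities at `x`. -/
structure IsExtremalRay (ℓ : κ → Module.Dual 𝕜 E) (x : E) : Prop where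
  nonneg : ∀ i, 0 ≤ ℓ i x
  ne_zero : x ≠ 0
  exists_eq_smul : ∀ u, (∀ i, ℓ i x = 0 → ℓ i u = 0) → ∃ t : 𝕜, u = t • x

lemma IsExtremalRay.smul {ℓ : κ → Module.Dual 𝕜 E} {x : E} (hx : IsExtremalRay ℓ x) {t : 𝕜}
    (ht : 0 < t) : IsExtremalRay ℓ (t • x) where
  nonneg i := by
    rw [map_smul]
    exact smul_nonneg ht.le (hx.nonneg i)
  ne_zero := smul_ne_zero ht.ne' hx.ne_zero
  exists_eq_smul u hu := by
    obtain ⟨s, rfl⟩ := hx.exists_eq_smul u fun i hi => hu i (by rw [map_smul, hi, smul_zero])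
    exact ⟨s * t⁻¹, by rw [smul_smul, inv_mul_cancel_right₀ ht.ne']⟩

variable [Finite κ] {ℓ : κ → Module.Dual 𝕜 E}

/-- The ray from `x` in the direction `-u` leaves the cone in a proper face of the minimal face
of `x`. -/
lemma exists_sub_smul_support_ssubset {x u : E} (hx : ∀ i, 0 ≤ ℓ i x)
    (hu : ∀ i, ℓ i x = 0 → ℓ i u = 0) (hpos : ∃ i, 0 < ℓ i u) :
    ∃ t : 𝕜, 0 < t ∧ (∀ i, 0 ≤ ℓ i (x - t • u)) ∧
      (Function.support fun i => ℓ i (x - t • u)) ⊂ Function.support fun i => ℓ i x := by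
  obtain ⟨i₀, hi₀, hmin⟩ := Set.exists_min_image {i | 0 < ℓ i u} (fun i => ℓ i x / ℓ i u)
    (Set.toFinite _) hpos
  have hx₀ : ℓ i₀ x ≠ 0 := fun h => hi₀.ne' (hu i₀ h)
  have ht : 0 < ℓ i₀ x / ℓ i₀ u := div_pos ((hx i₀).lt_of_ne' hx₀) hi₀
  refine ⟨_, ht, fun i => ?_, ?_, fun h => ?_⟩
  · rw [map_sub, map_smul, smul_eq_mul, sub_nonneg]
    rcases le_or_gt (ℓ i u) 0 with hi | hi
    · exact (mul_nonpos_of_nonneg_of_nonpos ht.le hi).trans (hx i)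
    · exact (le_div_iff₀ hi).1 (hmin i hi)
  · intro i hi h
    exact hi (by simp [h, hu i h])
  · refine h (a := i₀) hx₀ ?_
    simp [div_mul_cancel₀ _ (ne_of_gt hi₀)]

theorem mem_closure_isExtremalRay (hℓ : ∀ x, (∀ i, ℓ i x = 0) → x = 0) {x : E}
    (hx : ∀ i, 0 ≤ ℓ i x) : x ∈ AddSubmonoid.closure {y | IsExtremalRay ℓ y} := by
  induction hS : Function.support (fun i => ℓ i x) using WellFoundedLT.induction generalizing x with
  | ind S ih =>
    subst hS
    by_cases hx0 : x = 0
    · exact hx0 ▸ zero_mem _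
    by_cases hext : ∀ u, (∀ i, ℓ i x = 0 → ℓ i u = 0) → ∃ t : 𝕜, u = t • x
    · exact AddSubmonoid.subset_closure ⟨hx, hx0, hext⟩
    push Not at hext
    obtain ⟨u, hu, hux⟩ := hext
    wlog hpos : ∃ i, 0 < ℓ i u generalizing u
    · refine this (-u) (fun i hi => by simp [hu i hi]) (fun t h => hux (-t) ?_) ?_
      · rw [neg_smul, ← h, neg_neg]
      · by_contra! hneg
        push Not at hpos
        refine hux 0 ?_
        rw [zero_smul]
        exact hℓ u fun i => (hpos i).antisymm (by simpa using hneg i)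
    obtain ⟨t, ht, hy, hys⟩ := exists_sub_smul_support_ssubset hx hu hpos
    set y := x - t • u
    have hy_pos : ∃ i, 0 < ℓ i y := by
      by_contra! hle
      refine hux t⁻¹ ?_
      have hxt : x = t • u := sub_eq_zero.1 (hℓ y fun i => (hle i).antisymm (hy i))
      rw [hxt, inv_smul_smul₀ ht.ne']
    obtain ⟨s, hs, hz, hzs⟩ := exists_sub_smul_support_ssubset hx
      (fun i hi => by_contra fun h => hys.1 h hi) hy_pos
    have hsy : (Function.support fun i => ℓ i (s • y)) = Function.support fun i => ℓ i y := by
      ext i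
      simp [hs.ne']
    rw [← sub_add_cancel x (s • y)]
    exact add_mem (ih _ hzs hz rfl) (ih _ (hsy ▸ hys) (fun i => by
      rw [map_smul]; exact smul_nonneg hs.le (hy i)) rfl)

end ExtremalRays

section LatticePoints

/-- The inclusion of `ℕ ^ n` into `ℚ ^ n`. -/
def ratVec {n : ℕ} : (Fin n → ℕ) →+ (Fin n → ℚ) := (Nat.castAddMonoidHom ℚ).compLeft (Fin n)

@[simp]
lemma ratVec_apply {n : ℕ} (k : Fin n → ℕ) (j : Fin n) : ratVec k j = k j := rfl

lemma ratVec_nonneg {n : ℕ} (k : Fin n → ℕ) : 0 ≤ ratVec k := fun j => Nat.cast_nonneg (k j)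

lemma ratVec_le_ratVec {n : ℕ} {k k' : Fin n → ℕ} : ratVec k ≤ ratVec k' ↔ k ≤ k' :=
  forall_congr' fun _ => Nat.cast_le

lemma eq_of_gcd_eq_one_of_smul_eq {n : ℕ} {a a' : Fin n → ℕ} (ha : Finset.univ.gcd a = 1)
    (ha' : Finset.univ.gcd a' = 1) {t : ℚ} (ht : 0 ≤ t) (h : ratVec a' = t • ratVec a) :
    a' = a := by
  have hpq (j : Fin n) : t.den * a' j = t.num.toNat * a j := by
    have hj : (a' j : ℚ) = t * a j := congrFun h j
    have hnum : ((t.num.toNat : ℤ) : ℚ) = t.num := by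
      rw [Int.toNat_of_nonneg (Rat.num_nonneg.2 ht)]
    rw [← Rat.num_div_den t, div_mul_eq_mul_div, eq_div_iff (by simp), ← hnum] at hj
    rw [mul_comm]
    exact_mod_cast hj
  have hgcd : t.den = t.num.toNat := by
    have := congrArg Finset.univ.gcd (funext hpq)
    simpa [Finset.gcd_mul_left, ha, ha'] using this
  refine funext fun j => Nat.eq_of_mul_eq_mul_left t.den_pos ?_
  rw [hpq, hgcd]

lemma exists_gcd_eq_one_smul_eq {n : ℕ} {x : Fin n → ℚ} (hx : ∀ j, 0 ≤ x j) (hx0 : x ≠ 0) :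
    ∃ (a : Fin n → ℕ) (t : ℚ), 0 < t ∧ Finset.univ.gcd a = 1 ∧ x = t • ratVec a := by
  obtain ⟨⟨d, hd⟩, hint⟩ :=
    IsLocalization.exist_integer_multiples_of_finite (nonZeroDivisors ℤ) x
  choose z hz using hint
  obtain ⟨j₀, hj₀⟩ := Function.ne_iff.1 hx0
  have hd0 : 0 < |(d : ℚ)| := abs_pos.2 (by exact_mod_cast nonZeroDivisors.ne_zero hd)
  have hz' (j : Fin n) : ((z j).natAbs : ℚ) = |(d : ℚ)| * x j := by
    have hj : (z j : ℚ) = d * x j := by simpa [zsmul_eq_mul] using hz j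
    rw [Nat.cast_natAbs, Int.cast_abs, hj, abs_mul, abs_of_nonneg (hx j)]
  obtain ⟨a, ha, hgcd⟩ := Finset.extract_gcd (fun j => (z j).natAbs) ⟨j₀, Finset.mem_univ j₀⟩
  set g := Finset.univ.gcd fun j => (z j).natAbs
  have hxa : x = ((g : ℚ) / |(d : ℚ)|) • ratVec a := funext fun j => by
    have hj : ((z j).natAbs : ℚ) = g * a j := by exact_mod_cast ha j (Finset.mem_univ j)
    rw [Pi.smul_apply, smul_eq_mul, ratVec_apply, div_mul_eq_mul_div, ← hj, hz',
      mul_div_cancel_left₀ _ hd0.ne']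
  refine ⟨a, _, div_pos (Nat.cast_pos.2 (Nat.pos_of_ne_zero fun hg => hj₀ ?_)) hd0, hgcd, hxa⟩
  simp [hxa, hg]

variable {ι : Type*} {n : ℕ} (b : ι → Fin n → ℤ)

/-- The linear forms cutting out the cone `{x | 0 ≤ x ∧ ∀ i, 0 ≤ ⟨b i, x⟩}`. -/
def coneForm : Fin n ⊕ ι → Module.Dual ℚ (Fin n → ℚ) :=
  Sum.elim LinearMap.proj fun i => Fintype.linearCombination ℚ fun j => (b i j : ℚ)

lemma coneForm_inl (j : Fin n) (x : Fin n → ℚ) : coneForm b (.inl j) x = x j := rfl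

lemma coneForm_inr (i : ι) (x : Fin n → ℚ) : coneForm b (.inr i) x = ∑ j, b i j * x j := by
  simp [coneForm, Fintype.linearCombination_apply, mul_comm]

lemma coneForm_inr_ratVec (i : ι) (k : Fin n → ℕ) :
    coneForm b (.inr i) (ratVec k) = ((∑ j, b i j * (k j : ℤ) : ℤ) : ℚ) := by
  simp [coneForm_inr]

/-- `a` is the first nonzero lattice point on an extremal ray of the cone
`{x | 0 ≤ x ∧ ∀ i, 0 ≤ ⟨b i, x⟩}`. -/
structure IsPrimitiveRay (a : Fin n → ℕ) : Prop where
  gcd_eq_one : Finset.univ.gcd a = 1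
  isExtremalRay : IsExtremalRay (coneForm b) (ratVec a)

variable {b}

lemma IsPrimitiveRay.ne_zero {a : Fin n → ℕ} (ha : IsPrimitiveRay b a) : a ≠ 0 := fun h =>
  ha.isExtremalRay.ne_zero (by rw [h, map_zero])

lemma IsPrimitiveRay.sum_nonneg {a : Fin n → ℕ} (ha : IsPrimitiveRay b a) (i : ι) :
    0 ≤ ∑ j, b i j * (a j : ℤ) := by
  have h := ha.isExtremalRay.nonneg (.inr i)
  rw [coneForm_inr_ratVec] at h
  exact_mod_cast h

/-- The inequalities that are equalities at a rational extremal ray have rank `n - 1` over `ℚ`,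
hence also over `ℝ`; here this is read off by applying `ℚ`-linear functionals on `ℝ` to `u`. -/
lemma IsPrimitiveRay.exists_real_eq_mul {a : Fin n → ℕ} (ha : IsPrimitiveRay b a) {u : Fin n → ℝ}
    (hu : ∀ j, a j = 0 → u j = 0)
    (hbu : ∀ i, ∑ j, b i j * (a j : ℤ) = 0 → ∑ j, (b i j : ℝ) * u j = 0) :
    ∃ t : ℝ, ∀ j, u j = t * a j := by
  have hmul (j k : Fin n) : u j * a k = u k * a j := by
    rw [← sub_eq_zero, ← Module.forall_dual_apply_eq_zero_iff ℚ]
    intro ψ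
    obtain ⟨t, ht⟩ := ha.isExtremalRay.exists_eq_smul (fun j => ψ (u j)) (by
      rintro (j | i) h
      · rw [coneForm_inl, ratVec_apply, Nat.cast_eq_zero] at h
        rw [coneForm_inl, hu j h, map_zero]
      · rw [coneForm_inr_ratVec, Int.cast_eq_zero] at h
        rw [coneForm_inr, ← map_zero ψ, ← hbu i h, map_sum]
        refine Finset.sum_congr rfl fun j _ => ?_
        rw [← zsmul_eq_mul, ← zsmul_eq_mul, map_zsmul])
    have hψ (j k : Fin n) : ψ (u j * a k) = t * a j * a k := by
      rw [mul_comm, ← nsmul_eq_mul, map_nsmul, nsmul_eq_mul, mul_comm]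
      exact congrArg (· * (a k : ℚ)) (congrFun ht j)
    rw [map_sub, hψ, hψ]
    ring
  obtain ⟨k, hk⟩ := Function.ne_iff.1 ha.ne_zero
  refine ⟨u k / a k, fun j => ?_⟩
  rw [div_mul_eq_mul_div, ← hmul, mul_div_cancel_right₀ _ (by exact_mod_cast hk)]

lemma finite_isPrimitiveRay [Finite ι] (b : ι → Fin n → ℤ) : {a | IsPrimitiveRay b a}.Finite := by
  refine Set.Finite.of_injOn (f := fun a => {i | coneForm b i (ratVec a) = 0})
    (fun _ _ => Set.mem_univ _) (fun a ha a' ha' h => ?_) Set.finite_univ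
  obtain ⟨t, ht⟩ := ha.isExtremalRay.exists_eq_smul (ratVec a') fun i hi => h.subset hi
  obtain ⟨k, hk⟩ := Function.ne_iff.1 ha.ne_zero
  have hk' : 0 ≤ t * a k := by
    rw [← smul_eq_mul, ← ratVec_apply, ← Pi.smul_apply, ← ht]
    exact Nat.cast_nonneg _
  have ht0 : 0 ≤ t := nonneg_of_mul_nonneg_left hk' (by exact_mod_cast Nat.pos_of_ne_zero hk)
  exact (eq_of_gcd_eq_one_of_smul_eq ha.gcd_eq_one ha'.gcd_eq_one ht0 ht).symm

lemma exists_nonneg_combination [Finite ι] {m : ℕ} {a : Fin m → Fin n → ℕ}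
    (ha : Set.range a = {a | IsPrimitiveRay b a}) {x : Fin n → ℚ}
    (hx : ∀ i, 0 ≤ coneForm b i x) :
    ∃ c : Fin m → ℚ, (∀ r, 0 ≤ c r) ∧ x = ∑ r, c r • ratVec (a r) := by
  have hmem := mem_closure_isExtremalRay (fun x hx => funext fun j => hx (.inl j)) hx
  clear hx
  induction hmem using AddSubmonoid.closure_induction with
  | mem y hy =>
    obtain ⟨a', t, ht, hgcd, rfl⟩ := exists_gcd_eq_one_smul_eq (x := y)
      (fun j => hy.nonneg (.inl j)) hy.ne_zero
    have ha' : IsPrimitiveRay b a' :=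
      ⟨hgcd, by simpa [smul_smul, ht.ne'] using hy.smul (inv_pos.2 ht)⟩
    obtain ⟨r, rfl⟩ := ha.ge ha'
    refine ⟨Pi.single r t, Pi.single_nonneg.2 ht.le, ?_⟩
    simp [Pi.single_apply, ite_smul]
  | zero => exact ⟨0, fun _ => le_rfl, by simp⟩
  | add y z _ _ hy hz =>
    obtain ⟨c, hc, rfl⟩ := hy
    obtain ⟨d, hd, rfl⟩ := hz
    exact ⟨c + d, fun r => add_nonneg (hc r) (hd r), by
      simp only [Pi.add_apply, add_smul, Finset.sum_add_distrib]⟩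

variable (b) in
/-- The lattice points of the cone `{x | 0 ≤ x ∧ ∀ i, 0 ≤ ⟨b i, x⟩}`. -/
def latticeCone : AddSubmonoid (Fin n → ℕ) where
  carrier := {k | ∀ i, 0 ≤ ∑ j, b i j * (k j : ℤ)}
  zero_mem' := by simp
  add_mem' hk hk' i := by
    simpa [mul_add, Finset.sum_add_distrib] using add_nonneg (hk i) (hk' i)

lemma mem_latticeCone {k : Fin n → ℕ} :
    k ∈ latticeCone b ↔ ∀ i, 0 ≤ ∑ j, b i j * (k j : ℤ) := Iff.rfl

lemma mem_latticeCone_iff_coneForm {k : Fin n → ℕ} :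
    k ∈ latticeCone b ↔ ∀ i, 0 ≤ coneForm b i (ratVec k) := by
  simp only [mem_latticeCone, Sum.forall, coneForm_inl, coneForm_inr_ratVec, ratVec_apply,
    Nat.cast_nonneg, implies_true, true_and, Int.cast_nonneg_iff]

open scoped Pointwise

lemma exists_finite_add_closure_eq_latticeCone [Finite ι] {m : ℕ} {a : Fin m → Fin n → ℕ}
    (ha : Set.range a = {a | IsPrimitiveRay b a}) :
    ∃ H : Set (Fin n → ℕ), H.Finite ∧
      H + (AddSubmonoid.closure (Set.range a) : Set (Fin n → ℕ)) = latticeCone b := by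
  have hray (r : Fin m) : IsPrimitiveRay b (a r) := ha.le ⟨r, rfl⟩
  refine ⟨latticeCone b ∩ Set.Iic (∑ r, a r), (Set.finite_Iic _).inter_of_right _, ?_⟩
  refine subset_antisymm ?_ fun k hk => ?_
  · rintro _ ⟨h, hh, k, hk, rfl⟩
    refine add_mem hh.1 (AddSubmonoid.closure_le.2 ?_ hk)
    rintro _ ⟨r, rfl⟩
    exact (hray r).sum_nonneg
  · obtain ⟨c, hc, hk'⟩ := exists_nonneg_combination ha (mem_latticeCone_iff_coneForm.1 hk)
    set f := ∑ r, ⌊c r⌋₊ • a r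
    have hfract : ratVec k = ratVec f + ∑ r, (c r - ⌊c r⌋₊) • ratVec (a r) := by
      simp only [f, hk', map_sum, map_nsmul, sub_smul, Finset.sum_sub_distrib,
        Nat.cast_smul_eq_nsmul, add_sub_cancel]
    have hfract_nonneg (r : Fin m) : 0 ≤ c r - ⌊c r⌋₊ := sub_nonneg.2 (Nat.floor_le (hc r))
    have hfk : f ≤ k := by
      rw [← ratVec_le_ratVec, hfract]
      exact le_add_of_nonneg_right (Finset.sum_nonneg fun r _ =>
        smul_nonneg (hfract_nonneg r) (ratVec_nonneg _))
    obtain ⟨h, rfl⟩ := exists_add_of_le hfk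
    rw [map_add, add_right_inj] at hfract
    have hf : f ∈ AddSubmonoid.closure (Set.range a) :=
      sum_mem fun r _ => nsmul_mem (AddSubmonoid.subset_closure (Set.mem_range_self r)) _
    refine ⟨h, ?_, f, hf, add_comm h f⟩
    refine ⟨mem_latticeCone_iff_coneForm.2 fun i => ?_, ratVec_le_ratVec.1 ?_⟩
    · rw [hfract, map_sum]
      refine Finset.sum_nonneg fun r _ => ?_
      rw [map_smul]
      exact smul_nonneg (hfract_nonneg r) ((hray r).isExtremalRay.nonneg i)
    · rw [hfract, map_sum]
      refine Finset.sum_le_sum fun r _ => smul_le_of_le_one_left (ratVec_nonneg _) ?_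
      linarith [Nat.lt_floor_add_one (c r)]

/-- The lattice points of the polyhedron `{x | e ≤ x ∧ ∀ i, d i ≤ ⟨b i, x⟩}`. -/
def latticePolyhedron (e : Fin n → ℕ) (b : ι → Fin n → ℤ) (d : ι → ℤ) : Set (Fin n → ℕ) :=
  {k | e ≤ k ∧ ∀ i, d i ≤ ∑ j, b i j * (k j : ℤ)}

lemma exists_finite_add_latticeCone_eq [Finite ι] (e : Fin n → ℕ) (b : ι → Fin n → ℤ)
    (d : ι → ℤ) :
    ∃ G : Set (Fin n → ℕ), G.Finite ∧ G + (latticeCone b : Set (Fin n → ℕ)) =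
      latticePolyhedron e b d := by
  -- With the slacks adjoined as coordinates, differences of comparable points lie in the cone, and
  -- by well-quasi-ordering there are finitely many minimal points.
  let Φ (k : Fin n → ℕ) : (Fin n → ℕ) × (ι → ℕ) :=
    (k, fun i => (∑ j, b i j * (k j : ℤ) - d i).toNat)
  have hΦ : Function.Injective Φ := fun k k' h => (Prod.mk.inj h).1
  set T := Φ '' latticePolyhedron e b d
  have hfin : {x | Minimal (· ∈ T) x}.Finite :=
    WellQuasiOrderedLE.finite_of_isAntichain (setOfPred_minimal_antichain _)
  refine ⟨Φ ⁻¹' {x | Minimal (· ∈ T) x}, hfin.preimage hΦ.injOn, ?_⟩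
  refine subset_antisymm ?_ fun k hk => ?_
  · rintro _ ⟨g, hg, k, hk, rfl⟩
    obtain ⟨g', hg', h⟩ := hg.1
    obtain rfl := hΦ h
    refine ⟨hg'.1.trans (le_self_add : g' ≤ g' + k), fun i => ?_⟩
    have := add_le_add (hg'.2 i) (hk i)
    simpa [mul_add, Finset.sum_add_distrib] using this
  · obtain ⟨_, hle, hmin⟩ := exists_minimal_le_of_wellFoundedLT (· ∈ T) (Φ k) ⟨k, hk, rfl⟩
    obtain ⟨g, hg, rfl⟩ := hmin.1
    obtain ⟨f, rfl⟩ := exists_add_of_le hle.1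
    refine ⟨g, hmin, f, fun i => ?_, rfl⟩
    have hi := hle.2 i
    have h1 := hg.2 i
    have h2 := hk.2 i
    simp only [Φ, Pi.add_apply, Nat.cast_add, mul_add, Finset.sum_add_distrib] at hi h2
    omega

theorem exists_polynomial_tsum_mpow_latticePolyhedron {𝕜 : Type*} [NormedField 𝕜] [CompleteSpace 𝕜]
    [Finite ι] (e : Fin n → ℕ) (b : ι → Fin n → ℤ) (d : ι → ℤ) :
    ∃ (m : ℕ) (a : Fin m → Fin n → ℕ) (p : MvPolynomial (Fin n) ℤ), (∀ r, IsPrimitiveRay b (a r)) ∧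
      ∀ w : Fin n → 𝕜, (∀ j, ‖w j‖ < 1) →
        (∑' k : latticePolyhedron e b d, mpow w k) * ∏ r, (1 - mpow w (a r)) =
          MvPolynomial.aeval w p := by
  obtain ⟨m, a, -, ha⟩ := (finite_isPrimitiveRay b).fin_param
  have hray (r : Fin m) : IsPrimitiveRay b (a r) := ha.le ⟨r, rfl⟩
  obtain ⟨G, hG, hGC⟩ := exists_finite_add_latticeCone_eq e b d
  obtain ⟨H, hH, hHC⟩ := exists_finite_add_closure_eq_latticeCone ha
  obtain ⟨p, hp⟩ := exists_polynomial_tsum_mpow_add_closure (𝕜 := 𝕜) (hG.add hH)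
    fun r => (hray r).ne_zero
  refine ⟨m, a, p, hray, fun w hw => ?_⟩
  rw [← hGC, ← hHC, ← add_assoc]
  exact hp w hw

end LatticePoints

section NewtonPolyhedron

lemma finrank_add_one_eq_of_dotProduct {𝕜 : Type*} [Field 𝕜] {n : ℕ}
    {W : Submodule 𝕜 (Fin n → 𝕜)} {a : Fin n → 𝕜} (ha : a ≠ 0) (haW : ∀ x ∈ W, a ⬝ᵥ x = 0)
    (h : ∀ u : Fin n → 𝕜, (∀ x ∈ W, u ⬝ᵥ x = 0) → ∃ t : 𝕜, u = t • a) :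
    Module.finrank 𝕜 W + 1 = n := by
  let e := dotProductEquiv 𝕜 (Fin n)
  have hW : W.dualAnnihilator = Submodule.span 𝕜 {e a} := by
    ext f
    obtain ⟨u, rfl⟩ := e.surjective f
    rw [Submodule.mem_dualAnnihilator, Submodule.mem_span_singleton]
    constructor
    · intro hu
      obtain ⟨t, rfl⟩ := h u hu
      exact ⟨t, by simp⟩
    · rintro ⟨t, ht⟩ x hx
      rw [← ht]
      simp [e, haW x hx]
  have hrank := Subspace.finrank_add_finrank_dualAnnihilator_eq W
  rw [hW, finrank_span_singleton (by simpa using ha)] at hrank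
  simpa using hrank

variable {n : ℕ}

/-- The face of `Γ` on which the linear form `⟨a, ·⟩` attains its infimum `supportMin Γ a`. -/
def minFace (Γ : Set (Fin n → ℝ)) (a : Fin n → ℝ) : Set (Fin n → ℝ) :=
  {x ∈ Γ | a ⬝ᵥ x = supportMin Γ a}

section minFace

variable {Γ : Set (Fin n → ℝ)} {a : Fin n → ℝ}

lemma isExposed_minFace (hΓ : BddBelow ((fun x => a ⬝ᵥ x) '' Γ)) :
    IsExposed ℝ Γ (minFace Γ a) := by
  refine fun _ => ⟨-(LinearMap.toContinuousLinearMap (dotProductEquiv ℝ (Fin n) a)), ?_⟩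
  ext x
  refine and_congr_right fun hx => ?_
  have hmin : supportMin Γ a ≤ a ⬝ᵥ x := csInf_le hΓ ⟨x, hx, rfl⟩
  constructor
  · intro h y hy
    have hy' : supportMin Γ a ≤ a ⬝ᵥ y := csInf_le hΓ ⟨y, hy, rfl⟩
    simpa [h] using hy'
  · intro h
    refine le_antisymm (le_csInf ⟨_, x, hx, rfl⟩ ?_) hmin
    rintro _ ⟨y, hy, rfl⟩
    simpa using h y hy

theorem isFacet_minFace (hΓ : BddBelow ((fun x => a ⬝ᵥ x) '' Γ)) (ha : a ≠ 0) {x₀ : Fin n → ℝ}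
    (hx₀ : x₀ ∈ minFace Γ a)
    (h : ∀ u : Fin n → ℝ, (∀ x ∈ minFace Γ a, u ⬝ᵥ x = u ⬝ᵥ x₀) → ∃ t : ℝ, u = t • a) :
    IsFacet Γ (minFace Γ a) := by
  refine ⟨isExposed_minFace hΓ, ⟨x₀, hx₀⟩, finrank_add_one_eq_of_dotProduct ha ?_ fun u hu =>
    h u fun x hx => ?_⟩
  · have hker : vectorSpan ℝ (minFace Γ a) ≤ LinearMap.ker (dotProductEquiv ℝ (Fin n) a) := by
      rw [vectorSpan_def, Submodule.span_le]
      rintro _ ⟨y, hy, z, hz, rfl⟩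
      simp [dotProduct_sub, hy.2, hz.2]
    exact fun x hx => by simpa using hker hx
  · rw [← sub_eq_zero, ← dotProduct_sub]
    exact hu _ (vsub_mem_vectorSpan ℝ hx hx₀)

lemma isPrimitiveNormal_minFace {a : Fin n → ℕ} (ha : Finset.univ.gcd a = 1) :
    IsPrimitiveNormal (minFace Γ fun j => (a j : ℝ)) a :=
  ⟨ha, fun x hx y hy => by rw [dotProduct_sub, hx.2, hy.2, sub_self]⟩

end minFace

section Generators

variable {S : Set (Fin n → ℕ)} {m : Fin n → ℕ}

lemma add_mem_newtonPolyhedron (hm : m ∈ S) {y : Fin n → ℝ} (hy : 0 ≤ y) :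
    (fun j => (m j : ℝ)) + y ∈ newtonPolyhedron S :=
  subset_convexHull _ _ (Set.mem_biUnion hm ⟨y, hy, rfl⟩)

lemma mem_newtonPolyhedron (hm : m ∈ S) : (fun j => (m j : ℝ)) ∈ newtonPolyhedron S := by
  simpa using add_mem_newtonPolyhedron hm le_rfl

lemma le_dotProduct_of_mem_newtonPolyhedron {a : Fin n → ℝ} {c : ℝ} (ha : 0 ≤ a)
    (h : ∀ m ∈ S, c ≤ a ⬝ᵥ fun j => (m j : ℝ)) {x : Fin n → ℝ} (hx : x ∈ newtonPolyhedron S) :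
    c ≤ a ⬝ᵥ x := by
  have hconv : Convex ℝ {x : Fin n → ℝ | c ≤ a ⬝ᵥ x} :=
    convex_halfSpace_ge (dotProductEquiv ℝ (Fin n) a).isLinear c
  refine convexHull_min (Set.iUnion₂_subset fun m hm => ?_) hconv hx
  rintro _ ⟨y, hy, rfl⟩
  rw [Set.mem_ofPred_eq, dotProduct_add]
  exact le_add_of_le_of_nonneg (h m hm) (dotProduct_nonneg_of_nonneg ha hy)

end Generators

variable {l : ℕ} (N : Fin l → Fin n → ℕ) (i : Fin l)

/-- The rows `N i' - N i`: they cut out the cone of those `a ≥ 0` for which `N i` minimizes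
`⟨a, ·⟩` on the Newton polyhedron of `N`, i.e. the dual cone of `N i`. -/
def dualConeRows (i' : Fin l) (j : Fin n) : ℤ := N i' j - N i j

variable {N i}

lemma IsPrimitiveRay.dotProduct_le {a : Fin n → ℕ} (ha : IsPrimitiveRay (dualConeRows N i) a)
    (i' : Fin l) :
    (fun j => (a j : ℝ)) ⬝ᵥ (fun j => (N i j : ℝ)) ≤
      (fun j => (a j : ℝ)) ⬝ᵥ fun j => (N i' j : ℝ) := by
  have h := ha.sum_nonneg i'
  simp only [dualConeRows, sub_mul, Finset.sum_sub_distrib, sub_nonneg] at h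
  simp only [dotProduct, mul_comm (a _ : ℝ)]
  exact_mod_cast h

lemma IsPrimitiveRay.isLeast {a : Fin n → ℕ} (ha : IsPrimitiveRay (dualConeRows N i) a) :
    IsLeast ((fun x => (fun j => (a j : ℝ)) ⬝ᵥ x) '' newtonPolyhedron (Set.range N))
      ((fun j => (a j : ℝ)) ⬝ᵥ fun j => (N i j : ℝ)) := by
  refine ⟨⟨_, mem_newtonPolyhedron (Set.mem_range_self i), rfl⟩, ?_⟩
  rintro _ ⟨x, hx, rfl⟩
  refine le_dotProduct_of_mem_newtonPolyhedron (fun j => Nat.cast_nonneg _) ?_ hx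
  rintro _ ⟨i', rfl⟩
  exact ha.dotProduct_le i'

lemma IsPrimitiveRay.supportMin_eq {a : Fin n → ℕ} (ha : IsPrimitiveRay (dualConeRows N i) a) :
    supportMin (newtonPolyhedron (Set.range N)) (fun j => (a j : ℝ)) =
      ((∑ j, N i j * a j : ℕ) : ℝ) := by
  refine ha.isLeast.csInf_eq.trans ?_
  simp [dotProduct, mul_comm]

theorem IsPrimitiveRay.isFacet_minFace {a : Fin n → ℕ}
    (ha : IsPrimitiveRay (dualConeRows N i) a) :
    IsFacet (newtonPolyhedron (Set.range N))
      (minFace (newtonPolyhedron (Set.range N)) fun j => (a j : ℝ)) := by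
  have hmin := ha.isLeast.csInf_eq
  have hNi : (fun j => (N i j : ℝ)) ∈
      minFace (newtonPolyhedron (Set.range N)) fun j => (a j : ℝ) :=
    ⟨mem_newtonPolyhedron (Set.mem_range_self i), hmin.symm⟩
  refine MonomialIntegral.isFacet_minFace ha.isLeast.bddBelow (fun h => ha.ne_zero ?_) hNi
    fun u hu => ?_
  · exact funext fun j => by simpa using congrFun h j
  have hcoord (j : Fin n) (hj : a j = 0) : u j = 0 := by
    have hmem : (fun j => (N i j : ℝ)) + Pi.single j 1 ∈
        minFace (newtonPolyhedron (Set.range N)) fun j => (a j : ℝ) :=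
      ⟨add_mem_newtonPolyhedron (Set.mem_range_self i) (Pi.single_nonneg.2 zero_le_one), by
        rw [dotProduct_add, hNi.2, dotProduct_single, hj, Nat.cast_zero, zero_mul, add_zero]⟩
    simpa [dotProduct_add] using hu _ hmem
  have hrow (i' : Fin l) (hi' : ∑ j, dualConeRows N i i' j * (a j : ℤ) = 0) :
      ∑ j, (dualConeRows N i i' j : ℝ) * u j = 0 := by
    have hmem : (fun j => (N i' j : ℝ)) ∈
        minFace (newtonPolyhedron (Set.range N)) fun j => (a j : ℝ) := by
      refine ⟨mem_newtonPolyhedron (Set.mem_range_self i'), hNi.2 ▸ ?_⟩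
      simp only [dualConeRows, sub_mul, Finset.sum_sub_distrib, sub_eq_zero] at hi'
      simp only [dotProduct, mul_comm (a _ : ℝ)]
      exact_mod_cast hi'
    have h := sub_eq_zero.2 (hu _ hmem)
    rw [← dotProduct_sub] at h
    simpa [dotProduct, dualConeRows, mul_comm] using h
  obtain ⟨t, ht⟩ := ha.exists_real_eq_mul hcoord hrow
  exact ⟨t, funext ht⟩

end NewtonPolyhedron

section LocalField

variable {K : Type*} [Field K] [ValuativeRel K] [TopologicalSpace K]
  [IsNonarchimedeanLocalField K]

lemma one_lt_resCard : 1 < resCard K := Finite.one_lt_card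

lemma ord_one : ord (1 : K) = 0 := by simp [ord]

lemma ord_mul {x y : K} (hx : x ≠ 0) (hy : y ≠ 0) : ord (x * y) = ord x + ord y := by
  rw [ord, map_mul, map_mul, WithZero.log_mul (by simpa using hx) (by simpa using hy), neg_add,
    ord, ord]

lemma ord_pow (x : K) (m : ℕ) : ord (x ^ m) = m * ord x := by
  simp [ord, WithZero.log_pow]

lemma ord_prod {ι : Type*} (s : Finset ι) {f : ι → K} (hf : ∀ i ∈ s, f i ≠ 0) :
    ord (∏ i ∈ s, f i) = ∑ i ∈ s, ord (f i) := by
  classical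
  induction s using Finset.induction_on with
  | empty => simp [ord_one]
  | insert a s ha ih =>
    rw [Finset.forall_mem_insert] at hf
    rw [Finset.prod_insert ha, Finset.sum_insert ha,
      ord_mul hf.1 (Finset.prod_ne_zero_iff.2 hf.2), ih hf.2]

lemma ord_le_ord {x y : K} (hx : x ≠ 0) (hy : y ≠ 0) :
    ord x ≤ ord y ↔ valuation K y ≤ valuation K x := by
  rw [ord, ord, neg_le_neg_iff, WithZero.log_le_log (by simpa using hy) (by simpa using hx),
    map_le_map_iff]

lemma ord_nonneg_iff {x : K} (hx : x ≠ 0) : 0 ≤ ord x ↔ x ∈ 𝒪[K] := by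
  rw [← ord_one (K := K), ord_le_ord one_ne_zero hx, map_one, Valuation.mem_integer_iff]

lemma dvd_iff_ord_le {x y : 𝒪[K]} (hx : x ≠ 0) (hy : y ≠ 0) :
    x ∣ y ↔ ord (x : K) ≤ ord (y : K) := by
  rw [(Valuation.integer.integers (valuation K)).dvd_iff_le,
    ord_le_ord (by simpa using hx) (by simpa using hy)]
  rfl

variable (K) in
lemma exists_ord_eq_one : ∃ ϖ : 𝒪[K], ϖ ≠ 0 ∧ ord (ϖ : K) = 1 := by
  obtain ⟨π, hπ⟩ := ValuativeRel.valuation_surjective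
    ((IsNonarchimedeanLocalField.valueGroupWithZeroIsoInt K).symm (WithZero.exp (-1)))
  have hord : ord π = 1 := by
    rw [ord, hπ, OrderMonoidIso.apply_symm_apply, WithZero.log_exp, neg_neg]
  have hπ0 : π ≠ 0 := by
    rintro rfl
    simp [ord] at hord
  exact ⟨⟨π, (ord_nonneg_iff hπ0).1 (by lia)⟩, by simpa using hπ0, hord⟩

lemma isUnit_iff_ord_eq_zero {y : 𝒪[K]} (hy : y ≠ 0) : IsUnit y ↔ ord (y : K) = 0 := by
  rw [isUnit_iff_dvd_one, dvd_iff_ord_le hy one_ne_zero, OneMemClass.coe_one, ord_one]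
  exact ⟨fun h => h.antisymm ((ord_nonneg_iff (by simpa using hy)).2 y.2), le_of_eq⟩

lemma mem_maximalIdeal_pow_iff {m : ℕ} {y : 𝒪[K]} (hy : y ≠ 0) :
    y ∈ 𝓂[K] ^ m ↔ (m : ℤ) ≤ ord (y : K) := by
  obtain ⟨ϖ, hϖ, hord⟩ := exists_ord_eq_one K
  have hspan : 𝓂[K] = Ideal.span {ϖ} := by
    ext z
    obtain rfl | hz := eq_or_ne z 0
    · simp only [zero_mem]
    · have h0 := (ord_nonneg_iff (x := (z : K)) (by simpa using hz)).2 z.2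
      rw [IsLocalRing.mem_maximalIdeal, mem_nonunits_iff, isUnit_iff_ord_eq_zero hz,
        Ideal.mem_span_singleton, dvd_iff_ord_le hϖ hz]
      lia
  rw [hspan, Ideal.span_singleton_pow, Ideal.mem_span_singleton,
    dvd_iff_ord_le (pow_ne_zero m hϖ) hy, SubmonoidClass.coe_pow, ord_pow, hord, mul_one]

lemma absK_of_ord_eq {z : K} (hz : z ≠ 0) {m : ℕ} (hm : ord z = m) :
    absK z = ((resCard K : ℝ)⁻¹) ^ m := by
  rw [absK, if_neg hz, hm, zpow_neg, zpow_natCast, inv_pow]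

variable (K) in
/-- The ideal `𝒫_K ^ m` of `𝒪_K`, as a subset of `K`. -/
def primePow (m : ℕ) : Set K := (↑) '' ((𝓂[K] ^ m : Ideal 𝒪[K]) : Set 𝒪[K])

lemma mem_primePow {m : ℕ} {z : K} : z ∈ primePow K m ↔ z = 0 ∨ (m : ℤ) ≤ ord z := by
  obtain rfl | hz := eq_or_ne z 0
  · exact iff_of_true ⟨0, zero_mem _, rfl⟩ (Or.inl rfl)
  rw [or_iff_right hz]
  constructor
  · rintro ⟨y, hy, rfl⟩
    exact (mem_maximalIdeal_pow_iff (by simpa using hz)).1 hy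
  · intro h
    lift z to 𝒪[K] using (ord_nonneg_iff hz).1 (by lia)
    exact ⟨z, (mem_maximalIdeal_pow_iff (by simpa using hz)).2 h, rfl⟩

lemma primePow_zero : primePow K 0 = 𝒪[K] := by
  simp [primePow, Ideal.one_eq_top]

lemma zero_mem_primePow (m : ℕ) : (0 : K) ∈ primePow K m := mem_primePow.2 (Or.inl rfl)

variable (K) in
lemma secondCountableTopology : SecondCountableTopology K := by
  have : Countable (WithZero (Multiplicative ℤ)) := inferInstanceAs (Countable (Option ℤ))
  have : Countable (ValueGroupWithZero K) :=
    (IsNonarchimedeanLocalField.valueGroupWithZeroIsoInt K).injective.countable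
  let := IsTopologicalAddGroup.rightUniformSpace K
  have := isUniformAddGroup_of_addCommGroup (G := K)
  have : (nhds (0 : K)).IsCountablyGenerated :=
    Filter.HasCountableBasis.isCountablyGenerated
      ⟨IsValuativeTopology.hasBasis_nhds_zero' K, Set.to_countable _⟩
  have : (uniformity K).IsCountablyGenerated := IsUniformAddGroup.uniformity_countably_generated
  have : SigmaCompactSpace K := by
    refine SigmaCompactSpace.of_countable (Set.range fun γ => {x | valuation K x ≤ γ})
      (Set.countable_range _)
      (Set.forall_mem_range.2 (IsNonarchimedeanLocalField.isCompact_closedBall K))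
      (Set.sUnion_eq_univ_iff.2 fun x => ⟨_, ⟨valuation K x, rfl⟩, le_refl (valuation K x)⟩)
  let := UniformSpace.pseudoMetricSpace K
  exact EMetric.secondCountable_of_sigmaCompact K

lemma isOpen_primePow (m : ℕ) : IsOpen (primePow K m) := by
  obtain ⟨ϖ, hϖ, hord⟩ := exists_ord_eq_one K
  have hϖm : (ϖ : K) ^ m ≠ 0 := pow_ne_zero m (by simpa using hϖ)
  refine AddSubgroup.isOpen_of_mem_nhds (g := 0)
    ((𝓂[K] ^ m).toAddSubgroup.map 𝒪[K].subtype.toAddMonoidHom) ?_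
  refine (IsValuativeTopology.hasBasis_nhds_zero' K).mem_iff.2
    ⟨valuation K ((ϖ : K) ^ m), (valuation K).ne_zero_iff.2 hϖm, fun z hz => ?_⟩
  refine mem_primePow.2 (or_iff_not_imp_left.2 fun hz0 => ?_)
  have h := (ord_le_ord hϖm hz0).2 (le_of_lt hz)
  rwa [ord_pow, hord, mul_one] at h

variable (K) in
/-- The points of `K` of valuation `m`. -/
def sphere (m : ℕ) : Set K := {z | z ≠ 0 ∧ ord z = m}

lemma sphere_eq_diff (m : ℕ) : sphere K m = primePow K m \ primePow K (m + 1) := by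
  ext z
  simp only [sphere, Set.mem_ofPred_eq, Set.mem_sdiff, mem_primePow]
  push_cast
  grind

lemma primePow_anti {m m' : ℕ} (h : m ≤ m') : primePow K m' ⊆ primePow K m :=
  fun _ hz => mem_primePow.2 ((mem_primePow.1 hz).imp_right fun h' => by lia)

variable {n : ℕ}

variable (K) in
/-- The points `x` of `K ^ n` whose coordinates have valuations `k j`. -/
def shell (k : Fin n → ℕ) : Set (Fin n → K) := Set.univ.pi fun j => sphere K (k j)

lemma pairwise_disjoint_shell : Pairwise (Function.onFun Disjoint (shell K (n := n))) := by
  intro k k' hne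
  refine Set.disjoint_left.2 fun x hx hx' => hne (funext fun j => ?_)
  exact_mod_cast (hx j trivial).2.symm.trans (hx' j trivial).2

variable [MeasurableSpace K]

lemma measure_shell_ne_top {μ : Measure (Fin n → K)} (hμ : μ {x | ∀ j, x j ∈ 𝒪[K]} = 1)
    (k : Fin n → ℕ) : μ (shell K k) ≠ ⊤ := by
  refine ne_top_of_le_ne_top ENNReal.one_ne_top (hμ ▸ measure_mono fun x hx j => ?_)
  exact (ord_nonneg_iff (hx j trivial).1).1 ((hx j trivial).2 ▸ Int.natCast_nonneg _)

variable [BorelSpace K]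

lemma measure_primePow (ν : Measure K) [ν.IsAddHaarMeasure] (hν : ν 𝒪[K] = 1) (m : ℕ) :
    ν (primePow K m) = (resCard K : ENNReal)⁻¹ ^ m := by
  have hemb : MeasurableEmbedding (𝒪[K].subtype.toAddMonoidHom : 𝒪[K] → K) :=
    .subtype_coe (by simpa only [primePow_zero] using (isOpen_primePow (K := K) 0).measurableSet)
  have hinv := Measure.IsAddLeftInvariant.comap ν hemb
  have hindex : (𝓂[K] ^ m).toAddSubgroup.index = resCard K ^ m :=
    cardQuot_pow_of_prime (IsDiscreteValuationRing.not_a_field 𝒪[K])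
  have : (𝓂[K] ^ m).toAddSubgroup.FiniteIndex :=
    ⟨hindex ▸ pow_ne_zero m (one_lt_resCard.trans' zero_lt_one).ne'⟩
  have h := (𝓂[K] ^ m).toAddSubgroup.index_mul_measure
    (hemb.measurableSet_image.1 (isOpen_primePow m).measurableSet)
    (ν.comap 𝒪[K].subtype.toAddMonoidHom)
  rw [hindex, hemb.comap_apply, hemb.comap_apply, Set.image_univ] at h
  rw [← ENNReal.inv_pow]
  refine ENNReal.eq_inv_of_mul_eq_one_left ?_
  convert (mul_comm _ _).trans h using 1
  · push_cast
    rfl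
  · rw [← hν]
    exact congrArg ν Subtype.range_coe.symm

lemma measurableSet_sphere (m : ℕ) : MeasurableSet (sphere K m) := by
  rw [sphere_eq_diff]
  exact (isOpen_primePow m).measurableSet.diff (isOpen_primePow (m + 1)).measurableSet

lemma measureReal_sphere (ν : Measure K) [ν.IsAddHaarMeasure] (hν : ν 𝒪[K] = 1) (m : ℕ) :
    ν.real (sphere K m) = (1 - (resCard K : ℝ)⁻¹) * (resCard K : ℝ)⁻¹ ^ m := by
  have h (m : ℕ) : ν.real (primePow K m) = (resCard K : ℝ)⁻¹ ^ m := by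
    simp [measureReal_def, measure_primePow ν hν]
  rw [sphere_eq_diff, measureReal_sdiff (primePow_anti m.le_succ)
    (isOpen_primePow (m + 1)).measurableSet
    (by simp [measure_primePow ν hν, (one_lt_resCard.trans' zero_lt_one).ne']), h, h, pow_succ]
  ring

lemma measure_singleton_zero (ν : Measure K) [ν.IsAddHaarMeasure] (hν : ν 𝒪[K] = 1) :
    ν {0} = 0 := by
  have hq : (resCard K : ENNReal)⁻¹ < 1 :=
    ENNReal.inv_lt_one.2 (by exact_mod_cast one_lt_resCard)
  refine le_bot_iff.1 (ge_of_tendsto' (ENNReal.tendsto_pow_atTop_nhds_zero_of_lt_one hq)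
    fun m => ?_)
  rw [← measure_primePow ν hν]
  exact measure_mono (Set.singleton_subset_iff.2 (zero_mem_primePow m))

lemma exists_eq_pi (μ : Measure (Fin n → K)) [μ.IsAddHaarMeasure]
    (hμ : μ {x | ∀ j, x j ∈ 𝒪[K]} = 1) :
    ∃ ν : Measure K, ν.IsAddHaarMeasure ∧ ν 𝒪[K] = 1 ∧ μ = Measure.pi fun _ => ν := by
  have := secondCountableTopology K
  have hopen : IsOpen (𝒪[K] : Set K) := primePow_zero (K := K) ▸ isOpen_primePow 0
  have hcompact : IsCompact (𝒪[K] : Set K) :=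
    isCompact_iff_compactSpace.2 (inferInstanceAs (CompactSpace 𝒪[K]))
  have hinterior : (interior (𝒪[K] : Set K)).Nonempty :=
    ⟨0, hopen.interior_eq.symm ▸ zero_mem 𝒪[K]⟩
  let U : TopologicalSpace.PositiveCompacts K := ⟨⟨𝒪[K], hcompact⟩, hinterior⟩
  have hset : {x : Fin n → K | ∀ j, x j ∈ 𝒪[K]} = Set.univ.pi fun _ => (𝒪[K] : Set K) := by
    ext x
    simp
  let Un : TopologicalSpace.PositiveCompacts (Fin n → K) :=
    ⟨⟨Set.univ.pi fun _ => 𝒪[K], isCompact_univ_pi fun _ => hcompact⟩, by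
      simpa only [interior_pi_set Set.finite_univ, Set.univ_pi_nonempty_iff]
        using fun _ => hinterior⟩
  have hU : Measure.addHaarMeasure U 𝒪[K] = 1 := Measure.addHaarMeasure_self
  refine ⟨Measure.addHaarMeasure U, inferInstance, hU, ?_⟩
  rw [hset] at hμ
  rw [← (Measure.addHaarMeasure_eq_iff Un μ).2 hμ, Measure.addHaarMeasure_eq_iff Un]
  exact (Measure.pi_pi _ _).trans (Finset.prod_eq_one fun _ _ => hU)

lemma measurableSet_shell (k : Fin n → ℕ) : MeasurableSet (shell K k) :=
  .univ_pi fun j => measurableSet_sphere (k j)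

section Haar

variable (μ : Measure (Fin n → K)) [μ.IsAddHaarMeasure] (hμ : μ {x | ∀ j, x j ∈ 𝒪[K]} = 1)
include hμ

lemma measureReal_shell (k : Fin n → ℕ) :
    μ.real (shell K k) = (1 - (resCard K : ℝ)⁻¹) ^ n * (resCard K : ℝ)⁻¹ ^ ∑ j, k j := by
  obtain ⟨ν, _, hν, rfl⟩ := exists_eq_pi μ hμ
  have := secondCountableTopology K
  rw [measureReal_def, shell, Measure.pi_pi, ENNReal.toReal_prod]
  refine (Finset.prod_congr rfl fun j _ => measureReal_sphere ν hν (k j)).trans ?_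
  rw [Finset.prod_mul_distrib, Finset.prod_const, Finset.prod_pow_eq_pow_sum, Finset.card_univ,
    Fintype.card_fin]

lemma ae_forall_ne_zero : ∀ᵐ x ∂μ, ∀ j, x j ≠ 0 := by
  obtain ⟨ν, _, hν, rfl⟩ := exists_eq_pi μ hμ
  have := secondCountableTopology K
  refine ae_all_iff.2 fun j => ?_
  have h0 : Measure.pi (fun _ => ν) (Function.eval j ⁻¹' {0}) = 0 :=
    Measure.pi_eval_preimage_null _ (measure_singleton_zero ν hν)
  exact compl_mem_ae_iff.2 h0

lemma iUnion_shell_ae_eq_polydisc (e : ℕ) :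
    (⋃ k ∈ {k : Fin n → ℕ | ∀ j, e ≤ k j}, shell K k) =ᵐ[μ] polydisc K n e := by
  filter_upwards [ae_forall_ne_zero μ hμ] with x hx
  refine propext ⟨fun h j => ?_, fun h => ?_⟩
  · obtain ⟨k, hk, hxk⟩ := Set.mem_iUnion₂.1 h
    exact mem_primePow.2 (Or.inr ((hxk j trivial).2 ▸ Int.ofNat_le.2 (hk j)))
  · have hord (j : Fin n) : (e : ℤ) ≤ ord (x j) := (mem_primePow.1 (h j)).resolve_left (hx j)
    exact Set.mem_iUnion₂.2 ⟨fun j => (ord (x j)).toNat, fun j => by have := hord j; lia,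
      fun j _ => ⟨hx j, by have := hord j; lia⟩⟩

theorem integral_iUnion_shell {S : Set (Fin n → ℕ)} {F : (Fin n → K) → ℂ}
    {val : (Fin n → ℕ) → ℂ} (hF : ∀ k ∈ S, ∀ x ∈ shell K k, F x = val k)
    (hs : Summable fun k : S => ‖(resCard K : ℂ)⁻¹ ^ (∑ j, k.1 j) * val k‖) :
    IntegrableOn F (⋃ k : S, shell K k.1) μ ∧ ∫ x in ⋃ k : S, shell K k.1, F x ∂μ =
      (1 - (resCard K : ℂ)⁻¹) ^ n *
        ∑' k : S, (resCard K : ℂ)⁻¹ ^ (∑ j, k.1 j) * val k := by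
  have hFS (k : S) : Set.EqOn F (fun _ => val k) (shell K k.1) := hF k k.2
  have hi (k : S) : IntegrableOn F (shell K k.1) μ :=
    (integrableOn_const (measure_shell_ne_top hμ k.1)).congr_fun (hFS k).symm
      (measurableSet_shell k.1)
  have hsum : Summable fun k : S => ∫ x in shell K k.1, ‖F x‖ ∂μ := by
    refine (hs.mul_left ((1 - (resCard K : ℝ)⁻¹) ^ n)).congr fun k => ?_
    rw [setIntegral_congr_fun (measurableSet_shell k.1) fun x hx => congrArg norm (hFS k hx),
      setIntegral_const, measureReal_shell μ hμ, norm_mul, norm_pow, norm_inv,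
      Complex.norm_natCast, smul_eq_mul, mul_assoc]
  have hint := integrableOn_iUnion_of_summable_integral_norm hi hsum
  have hdisj : Pairwise (Function.onFun Disjoint fun k : S => shell K k.1) :=
    fun k k' hne => pairwise_disjoint_shell (Subtype.coe_ne_coe.2 hne)
  have hadd := integral_iUnion (fun k : S => measurableSet_shell k.1) hdisj hint
  refine ⟨hint, hadd.trans ?_⟩
  rw [← tsum_mul_left]
  refine tsum_congr fun k => ?_
  rw [setIntegral_congr_fun (measurableSet_shell k.1) (hFS k), setIntegral_const,
    measureReal_shell μ hμ, Complex.real_smul]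
  push_cast
  ring

end Haar

end LocalField

section Cells

variable {n l : ℕ}

/-- The contributions `Q ^ (v j + 1) * T ^ M j` of the coordinates to the monomial
`Q ^ (∑ j, k j + ⟨v, k⟩) * T ^ ⟨M, k⟩` attached to an exponent vector `k`. -/
def cellWeight {R : Type*} [Monoid R] (Q T : R) (v M : Fin n → ℕ) (j : Fin n) : R :=
  Q ^ (v j + 1) * T ^ M j

lemma mpow_cellWeight {R : Type*} [CommMonoid R] (Q T : R) (v M k : Fin n → ℕ) :
    mpow (cellWeight Q T v M) k = Q ^ (∑ j, k j + v ⬝ᵥ k) * T ^ (M ⬝ᵥ k) := by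
  simp only [mpow, cellWeight, dotProduct, mul_pow, ← pow_mul, Finset.prod_mul_distrib,
    Finset.prod_pow_eq_pow_sum, add_mul, one_mul, Finset.sum_add_distrib, add_comm]

lemma pow_sum_mul_eq_mul_mpow_cellWeight {R : Type*} [CommMonoid R] (Q T : R) (g : ℕ)
    (v M k : Fin n → ℕ) :
    Q ^ (∑ j, k j) * (T ^ (g + M ⬝ᵥ k) * Q ^ (v ⬝ᵥ k)) =
      T ^ g * mpow (cellWeight Q T v M) k := by
  simp only [mpow_cellWeight, pow_add]
  ac_rfl

lemma norm_cellWeight_lt_one {𝕜 : Type*} [NormedField 𝕜] {Q T : 𝕜} (hQ : ‖Q‖ < 1) (hT : ‖T‖ ≤ 1)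
    (v M : Fin n → ℕ) (j : Fin n) : ‖cellWeight Q T v M j‖ < 1 := by
  rw [cellWeight, norm_mul, norm_pow, norm_pow]
  exact mul_lt_one_of_nonneg_of_lt_one_left (by positivity)
    (pow_lt_one₀ (norm_nonneg Q) hQ (v j).succ_ne_zero) (pow_le_one₀ (norm_nonneg T) hT)

variable (N : Fin l → Fin n → ℕ) (G : Fin l → ℕ) (e : ℕ)

/-- The exponents `k ≥ e` at which `i` is the first index minimizing `G i + ⟨N i, k⟩`. -/
def minCell (i : Fin l) : Set (Fin n → ℕ) :=
  latticePolyhedron (fun _ => e) (dualConeRows N i)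
    fun i' => G i - G i' + if i' < i then 1 else 0

variable {N G e}

lemma mem_minCell {i : Fin l} {k : Fin n → ℕ} :
    k ∈ minCell N G e i ↔ (∀ j, e ≤ k j) ∧
      ∀ i', toLex (G i + N i ⬝ᵥ k, i) ≤ toLex (G i' + N i' ⬝ᵥ k, i') := by
  refine and_congr Iff.rfl (forall_congr' fun i' => ?_)
  have hrow : ∑ j, dualConeRows N i i' j * (k j : ℤ) = (N i' ⬝ᵥ k : ℕ) - (N i ⬝ᵥ k : ℕ) := by
    simp only [dotProduct, dualConeRows, sub_mul, Finset.sum_sub_distrib]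
    push_cast
    rfl
  rw [hrow, Prod.Lex.toLex_le_toLex]
  grind

lemma pairwise_disjoint_minCell : Pairwise (Function.onFun Disjoint (minCell N G e)) := by
  intro i i' hne
  refine Set.disjoint_left.2 fun k hk hk' => hne ?_
  exact congrArg (·.2) (toLex.injective
    (((mem_minCell.1 hk).2 i').antisymm ((mem_minCell.1 hk').2 i)))

lemma iUnion_minCell [Nonempty (Fin l)] : ⋃ i, minCell N G e i = {k | ∀ j, e ≤ k j} := by
  ext k
  obtain ⟨i, hi⟩ := Finite.exists_min fun i => toLex (G i + N i ⬝ᵥ k, i)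
  simp only [Set.mem_iUnion, mem_minCell]
  exact ⟨fun ⟨_, hk, _⟩ => hk, fun hk => ⟨i, hk, hi⟩⟩

end Cells

section Integral

variable {K : Type*} [Field K] [ValuativeRel K] [TopologicalSpace K]
  [IsNonarchimedeanLocalField K] {n l : ℕ}

lemma natCast_inv_pow_cpow (q m : ℕ) (s : ℂ) : ((q : ℂ)⁻¹ ^ m) ^ s = ((q : ℂ) ^ (-s)) ^ m := by
  have harg : ((q : ℂ) ^ m).arg ≠ Real.pi := by
    rw [← Nat.cast_pow, Complex.natCast_arg]
    exact Real.pi_ne_zero.symm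
  rw [inv_pow, Complex.inv_cpow _ _ harg, ← Complex.natCast_cpow_natCast_mul, Complex.cpow_neg,
    inv_pow, Complex.cpow_nat_mul]

section Shell

variable {k : Fin n → ℕ} {x : Fin n → K} (hx : x ∈ shell K k)
include hx

lemma monom_ne_zero_of_mem_shell (M : Fin n → ℕ) : monom M x ≠ 0 :=
  Finset.prod_ne_zero_iff.2 fun j _ => pow_ne_zero _ (hx j trivial).1

lemma ord_monom_of_mem_shell (M : Fin n → ℕ) : ord (monom M x) = (M ⬝ᵥ k : ℕ) := by
  rw [monom, ord_prod _ fun j _ => pow_ne_zero _ (hx j trivial).1, dotProduct, Nat.cast_sum]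
  exact Finset.sum_congr rfl fun j _ => by rw [ord_pow, (hx j trivial).2, Nat.cast_mul]

lemma absK_mul_monom_of_mem_shell {c : 𝒪[K]} (hc : c ≠ 0) (M : Fin n → ℕ) :
    absK (c * monom M x) = (resCard K : ℝ)⁻¹ ^ ((ord (c : K)).toNat + M ⬝ᵥ k) := by
  have hc' : (c : K) ≠ 0 := by simpa using hc
  have hM := monom_ne_zero_of_mem_shell hx M
  refine absK_of_ord_eq (mul_ne_zero hc' hM) ?_
  rw [ord_mul hc' hM, ord_monom_of_mem_shell hx, Nat.cast_add,
    Int.toNat_of_nonneg ((ord_nonneg_iff hc').2 c.2)]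

variable {N : Fin l → Fin n → ℕ} {c : Fin l → 𝒪[K]} {e : ℕ} {i : Fin l}

lemma normK_of_mem_shell (hc : ∀ i, c i ≠ 0)
    (hk : k ∈ minCell N (fun i => (ord (c i : K)).toNat) e i) :
    normK (fun i => c i * monom (N i) x) =
      (resCard K : ℝ)⁻¹ ^ ((ord (c i : K)).toNat + N i ⬝ᵥ k) := by
  refine IsGreatest.csSup_eq ⟨⟨i, absK_mul_monom_of_mem_shell hx (hc i) (N i)⟩, ?_⟩
  rintro _ ⟨i', rfl⟩
  have hle := (Prod.Lex.toLex_le_toLex'.1 ((mem_minCell.1 hk).2 i')).1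
  simp only [absK_mul_monom_of_mem_shell hx (hc i')]
  exact pow_le_pow_of_le_one (by positivity)
    (inv_le_one_of_one_le₀ (by exact_mod_cast one_lt_resCard.le)) hle

lemma integrand_of_mem_shell (hc : ∀ i, c i ≠ 0)
    (hk : k ∈ minCell N (fun i => (ord (c i : K)).toNat) e i) (v : Fin n → ℕ) (s : ℂ) :
    integrand N v c s x = ((resCard K : ℂ) ^ (-s)) ^ ((ord (c i : K)).toNat + N i ⬝ᵥ k) *
      (resCard K : ℂ)⁻¹ ^ (v ⬝ᵥ k) := by
  rw [integrand, normK_of_mem_shell hx hc hk,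
    absK_of_ord_eq (monom_ne_zero_of_mem_shell hx v) (ord_monom_of_mem_shell hx v)]
  push_cast
  rw [natCast_inv_pow_cpow]

end Shell

variable (K) in
lemma norm_inv_resCard_lt_one : ‖(resCard K : ℂ)⁻¹‖ < 1 := by
  rw [norm_inv, Complex.norm_natCast]
  exact inv_lt_one_of_one_lt₀ (by exact_mod_cast one_lt_resCard)

variable (K) in
lemma norm_resCard_cpow_neg_le_one {s : ℂ} (hs : 0 ≤ s.re) : ‖(resCard K : ℂ) ^ (-s)‖ ≤ 1 := by
  rw [Complex.norm_natCast_cpow_of_pos (one_lt_resCard.trans' zero_lt_one), Complex.neg_re]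
  exact Real.rpow_le_one_of_one_le_of_nonpos (by exact_mod_cast one_lt_resCard.le)
    (neg_nonpos.2 hs)

variable [MeasurableSpace K] [BorelSpace K] (μ : Measure (Fin n → K)) [μ.IsAddHaarMeasure]
  (hμ : μ {x | ∀ j, x j ∈ 𝒪[K]} = 1) {N : Fin l → Fin n → ℕ} {v : Fin n → ℕ} {c : Fin l → 𝒪[K]}
  (hc : ∀ i, c i ≠ 0) {e : ℕ} {s : ℂ} (hs : 0 ≤ s.re)
include hμ hc hs

lemma integral_iUnion_minCell_shell (i : Fin l) :
    IntegrableOn (integrand N v c s)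
        (⋃ k : minCell N (fun i => (ord (c i : K)).toNat) e i, shell K k.1) μ ∧
      ∫ x in ⋃ k : minCell N (fun i => (ord (c i : K)).toNat) e i, shell K k.1,
          integrand N v c s x ∂μ =
        (1 - (resCard K : ℂ)⁻¹) ^ n * (((resCard K : ℂ) ^ (-s)) ^ (ord (c i : K)).toNat *
          ∑' k : minCell N (fun i => (ord (c i : K)).toNat) e i,
            mpow (cellWeight (resCard K : ℂ)⁻¹ ((resCard K : ℂ) ^ (-s)) v (N i)) k) := by
  have hw := norm_cellWeight_lt_one (norm_inv_resCard_lt_one K) (norm_resCard_cpow_neg_le_one K hs)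
    v (N i)
  have hsum : Summable fun k : minCell N (fun i => (ord (c i : K)).toNat) e i =>
      ‖(resCard K : ℂ)⁻¹ ^ (∑ j, k.1 j) * (((resCard K : ℂ) ^ (-s)) ^
        ((ord (c i : K)).toNat + N i ⬝ᵥ k.1) * (resCard K : ℂ)⁻¹ ^ (v ⬝ᵥ k.1))‖ := by
    simp only [pow_sum_mul_eq_mul_mpow_cellWeight, norm_mul]
    exact ((summable_mpow hw).subtype _).mul_left _
  have h := integral_iUnion_shell μ hμ
    (fun k hk x hx => integrand_of_mem_shell hx hc hk v s) hsum
  simpa only [pow_sum_mul_eq_mul_mpow_cellWeight, tsum_mul_left] using h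

theorem integral_polydisc_eq_sum_tsum [Nonempty (Fin l)] :
    IntegrableOn (integrand N v c s) (polydisc K n e) μ ∧
      ∫ x in polydisc K n e, integrand N v c s x ∂μ =
        (1 - (resCard K : ℂ)⁻¹) ^ n * ∑ i, ((resCard K : ℂ) ^ (-s)) ^ (ord (c i : K)).toNat *
          ∑' k : minCell N (fun i => (ord (c i : K)).toNat) e i,
            mpow (cellWeight (resCard K : ℂ)⁻¹ ((resCard K : ℂ) ^ (-s)) v (N i)) k := by
  set U : Fin l → Set (Fin n → K) :=
    fun i => ⋃ k : minCell N (fun i => (ord (c i : K)).toNat) e i, shell K k.1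
  have hU (i : Fin l) : MeasurableSet (U i) := .iUnion fun k => measurableSet_shell k.1
  have hdisj : Pairwise (Function.onFun Disjoint U) := fun i i' hne =>
    Set.disjoint_iUnion_left.2 fun k => Set.disjoint_iUnion_right.2 fun k' =>
      pairwise_disjoint_shell (pairwise_disjoint_minCell hne |>.ne_of_mem k.2 k'.2)
  have hae : ⋃ i, U i =ᵐ[μ] polydisc K n e := by
    have h := iUnion_shell_ae_eq_polydisc μ hμ e
    rw [← iUnion_minCell (N := N) (G := fun i => (ord (c i : K)).toNat), Set.biUnion_iUnion] at h
    simpa only [U, Set.iUnion_subtype] using h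
  have hint (i : Fin l) := integral_iUnion_minCell_shell μ hμ (N := N) (v := v) (e := e) hc hs i
  refine ⟨(integrableOn_finite_iUnion.2 fun i => (hint i).1).congr_set_ae hae.symm, ?_⟩
  rw [← setIntegral_congr_set hae, integral_iUnion_fintype hU hdisj fun i => (hint i).1,
    Finset.mul_sum]
  exact Finset.sum_congr rfl fun i _ => (hint i).2

end Integral

section Rationality

open Polynomial

lemma eval_ratFunc_div {P D : ℂ[X]} {z : ℂ} (hz : D.eval z ≠ 0) :
    (algebraMap ℂ[X] (RatFunc ℂ) P / algebraMap ℂ[X] (RatFunc ℂ) D).eval (RingHom.id ℂ) z =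
      P.eval z / D.eval z := by
  have hD : D ≠ 0 := fun h => hz (h ▸ eval_zero)
  have hden : (RatFunc.denom (algebraMap ℂ[X] (RatFunc ℂ) P / algebraMap _ _ D)).eval z ≠ 0 := by
    obtain ⟨E, hE⟩ := RatFunc.denom_div_dvd P D
    rw [hE, eval_mul] at hz
    exact left_ne_zero_of_mul hz
  have hcross := congrArg (eval z) ((RatFunc.num_mul_eq_mul_denom_iff (p := P) hD).2 rfl)
  rw [eval_mul, eval_mul] at hcross
  rw [RatFunc.eval, eval₂_id, eval₂_id, div_eq_div_iff hden hz, hcross]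

lemma analyticAt_eval_cpow_neg {q : ℂ} (hq : q ≠ 0) (P : ℂ[X]) (s : ℂ) :
    AnalyticAt ℂ (fun s : ℂ => P.eval (q ^ (-s))) s := by
  have h : AnalyticAt ℂ (fun s : ℂ => q ^ (-s)) s := by
    simp only [Complex.cpow_def_of_ne_zero hq]
    fun_prop
  simpa using h.aeval_polynomial P

lemma meromorphic_ratFunc_eval_cpow_neg {q : ℂ} (hq : q ≠ 0) (R : RatFunc ℂ) :
    Meromorphic fun s : ℂ => R.eval (RingHom.id ℂ) (q ^ (-s)) := by
  intro s
  simp only [RatFunc.eval, eval₂_id]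
  exact (analyticAt_eval_cpow_neg hq _ s).meromorphicAt.div
    (analyticAt_eval_cpow_neg hq _ s).meromorphicAt

lemma eval_eq_zero_of_isPole {q : ℂ} (hq : q ≠ 0) {P D : ℂ[X]} {s : ℂ}
    (hs : IsPole (fun s : ℂ => (algebraMap ℂ[X] (RatFunc ℂ) P / algebraMap _ _ D).eval
      (RingHom.id ℂ) (q ^ (-s))) s) : D.eval (q ^ (-s)) = 0 := by
  by_contra h
  have hD := analyticAt_eval_cpow_neg hq D s
  have hdiv := (analyticAt_eval_cpow_neg hq P s).div hD h
  refine hs.2.not_ge (hdiv.congr ?_).meromorphicOrderAt_nonneg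
  filter_upwards [hD.continuousAt.eventually_ne h] with z hz using (eval_ratFunc_div hz).symm

lemma eq_of_inv_pow_mul_cpow_pow_eq_one {q : ℕ} (hq : 1 < q) {A m : ℕ} (hA : A ≠ 0) {s : ℂ}
    (h : (q : ℂ)⁻¹ ^ A * ((q : ℂ) ^ (-s)) ^ m = 1) :
    m ≠ 0 ∧ ∃ k : ℤ, s = -(A : ℂ) / m +
      2 * (Real.pi : ℂ) * Complex.I * k / (m * (Real.log q : ℂ)) := by
  have hq0 : (q : ℂ) ≠ 0 := by exact_mod_cast (zero_lt_one.trans hq).ne'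
  have hlog : (Real.log q : ℂ) ≠ 0 := by
    exact_mod_cast (Real.log_pos (by exact_mod_cast hq)).ne'
  have hexp : (q : ℂ)⁻¹ ^ A * ((q : ℂ) ^ (-s)) ^ m =
      Complex.exp (-(A + m * s) * Real.log q) := by
    rw [inv_pow, ← Complex.cpow_natCast, ← Complex.cpow_neg, ← Complex.cpow_nat_mul,
      ← Complex.cpow_add _ _ hq0, Complex.cpow_def_of_ne_zero hq0, Complex.natCast_log]
    congr 1
    ring
  obtain ⟨k, hk⟩ := Complex.exp_eq_one_iff.1 (hexp.symm.trans h)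
  have hm : m ≠ 0 := by
    rintro rfl
    rw [pow_zero, mul_one, inv_pow, inv_eq_one] at h
    exact (Nat.one_lt_pow hA hq).ne' (by exact_mod_cast h)
  have hm' : (m : ℂ) ≠ 0 := by exact_mod_cast hm
  refine ⟨hm, -k, ?_⟩
  rw [Int.cast_neg]
  field_simp
  linear_combination -hk

variable {n l : ℕ}

lemma IsPrimitiveRay.eq_of_mpow_cellWeight_eq_one {ι : Type*} {b : ι → Fin n → ℤ} {a : Fin n → ℕ}
    (ha : IsPrimitiveRay b a) {q : ℕ} (hq : 1 < q) {s : ℂ} {v M : Fin n → ℕ}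
    (h : mpow (cellWeight (q : ℂ)⁻¹ ((q : ℂ) ^ (-s)) v M) a = 1) :
    M ⬝ᵥ a ≠ 0 ∧ ∃ k : ℤ, s = -((∑ j, a j : ℕ) + (v ⬝ᵥ a : ℕ)) / (M ⬝ᵥ a : ℕ) +
      2 * (Real.pi : ℂ) * Complex.I * k / ((M ⬝ᵥ a : ℕ) * (Real.log q : ℂ)) := by
  have hσ : ∑ j, a j ≠ 0 := fun h0 =>
    ha.ne_zero (funext fun j => Finset.sum_eq_zero_iff.1 h0 j (Finset.mem_univ j))
  rw [mpow_cellWeight] at h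
  rw [← Nat.cast_add]
  exact eq_of_inv_pow_mul_cpow_pow_eq_one hq (fun h0 => hσ (Nat.add_eq_zero_iff.1 h0).1) h

lemma exists_polynomial_tsum_mpow_cellWeight {ι : Type*} [Finite ι] (e : Fin n → ℕ)
    (b : ι → Fin n → ℤ) (d : ι → ℤ) {Q : ℂ} (hQ : ‖Q‖ < 1) (v M : Fin n → ℕ) :
    ∃ P D : ℂ[X],
      (∀ T, D.eval T = 0 → ∃ a, IsPrimitiveRay b a ∧ mpow (cellWeight Q T v M) a = 1) ∧
      ∀ T, ‖T‖ ≤ 1 → (∑' k : latticePolyhedron e b d, mpow (cellWeight Q T v M) k) * D.eval T =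
        P.eval T := by
  obtain ⟨m, a, p, ha, hp⟩ := exists_polynomial_tsum_mpow_latticePolyhedron (𝕜 := ℂ) e b d
  have hcomp (T : ℂ) : eval T ∘ cellWeight (C Q) X v M = cellWeight Q T v M := by
    ext j
    simp [cellWeight]
  have hP (T : ℂ) : (MvPolynomial.aeval (cellWeight (C Q) X v M) p).eval T =
      MvPolynomial.aeval (cellWeight Q T v M) p := by
    rw [← hcomp T]
    exact MvPolynomial.comp_aeval_apply _ (evalRingHom T).toIntAlgHom p
  have hD (T : ℂ) : (∏ r, (1 - mpow (cellWeight (C Q) X v M) (a r))).eval T =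
      ∏ r, (1 - mpow (cellWeight Q T v M) (a r)) := by
    rw [eval_prod, ← hcomp T]
    refine Finset.prod_congr rfl fun r _ => ?_
    rw [eval_sub, eval_one]
    exact congrArg _ (map_mpow (evalRingHom T) _ (a r))
  refine ⟨MvPolynomial.aeval (cellWeight (C Q) X v M) p,
    ∏ r, (1 - mpow (cellWeight (C Q) X v M) (a r)), fun T hT => ?_, fun T hT => ?_⟩
  · rw [hD, Finset.prod_eq_zero_iff] at hT
    obtain ⟨r, -, hr⟩ := hT
    exact ⟨a r, ha r, (sub_eq_zero.1 hr).symm⟩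
  · rw [hP, hD, hp _ (norm_cellWeight_lt_one hQ hT v M)]

theorem exists_polynomial_sum_tsum_minCell {Q : ℂ} (hQ : ‖Q‖ < 1) (A : ℂ) (N : Fin l → Fin n → ℕ)
    (G : Fin l → ℕ) (e : ℕ) (v : Fin n → ℕ) :
    ∃ P D : ℂ[X],
      (∀ T, D.eval T = 0 →
        ∃ i a, IsPrimitiveRay (dualConeRows N i) a ∧ mpow (cellWeight Q T v (N i)) a = 1) ∧
      ∀ T, ‖T‖ ≤ 1 → (A * ∑ i, T ^ G i *
        ∑' k : minCell N G e i, mpow (cellWeight Q T v (N i)) k) * D.eval T = P.eval T := by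
  choose P D hD hP using fun i => exists_polynomial_tsum_mpow_cellWeight (fun _ => e)
    (dualConeRows N i) (fun i' => G i - G i' + if i' < i then 1 else 0) hQ v (N i)
  refine ⟨C A * ∑ i, X ^ G i * (P i * ∏ i' ∈ Finset.univ.erase i, D i'), ∏ i, D i,
    fun T hT => ?_, fun T hT => ?_⟩
  · rw [eval_prod, Finset.prod_eq_zero_iff] at hT
    obtain ⟨i, -, hi⟩ := hT
    exact ⟨i, hD i T hi⟩
  · simp only [mul_assoc, Finset.sum_mul, eval_mul, eval_C, eval_finsetSum, eval_pow, eval_X]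
    refine congrArg _ (Finset.sum_congr rfl fun i _ => ?_)
    rw [← Finset.mul_prod_erase _ _ (Finset.mem_univ i), eval_mul, ← hP i T hT, minCell, mul_assoc]

end Rationality

end MonomialIntegral

open MonomialIntegral in
theorem lemma3p1 {K : Type*} [Field K] [ValuativeRel K] [TopologicalSpace K]
    [IsNonarchimedeanLocalField K] [MeasurableSpace K] [BorelSpace K]
    {n l : ℕ} (hl : 1 ≤ l)
    (μ : Measure (Fin n → K)) [μ.IsAddHaarMeasure]
    (hμ : μ {x | ∀ j, x j ∈ 𝒪[K]} = 1)
    (N : Fin l → Fin n → ℕ) (hN : ∀ i, N i ≠ 0) (v : Fin n → ℕ)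
    (c : Fin l → 𝒪[K]) (hc : ∀ i, c i ≠ 0) (e₀ : ℕ) :
    ∃ R : RatFunc ℂ,
      (∀ s : ℂ, 0 < s.re →
        IntegrableOn (MonomialIntegral.integrand N v c s) (MonomialIntegral.polydisc K n e₀) μ ∧
        ∫ x in MonomialIntegral.polydisc K n e₀, MonomialIntegral.integrand N v c s x ∂μ
          = R.eval (RingHom.id ℂ) ((MonomialIntegral.resCard K : ℂ) ^ (-s))) ∧
      Meromorphic (fun s : ℂ => R.eval (RingHom.id ℂ) ((MonomialIntegral.resCard K : ℂ) ^ (-s))) ∧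
      ∀ s : ℂ,
        MonomialIntegral.IsPole
          (fun s : ℂ => R.eval (RingHom.id ℂ) ((MonomialIntegral.resCard K : ℂ) ^ (-s))) s →
        ∃ (γ : Set (Fin n → ℝ)) (a : Fin n → ℕ) (m : ℝ) (k : ℤ),
          MonomialIntegral.IsFacet (MonomialIntegral.newtonPolyhedron (Set.range N)) γ ∧
          MonomialIntegral.IsPrimitiveNormal γ a ∧
          m = MonomialIntegral.supportMin (MonomialIntegral.newtonPolyhedron (Set.range N))
            (fun j => (a j : ℝ)) ∧
          γ = {x ∈ MonomialIntegral.newtonPolyhedron (Set.range N) |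
            (fun j => (a j : ℝ)) ⬝ᵥ x = m} ∧
          m ≠ 0 ∧
          s = -(((∑ j, a j : ℕ) : ℂ) + ((∑ j, v j * a j : ℕ) : ℂ)) / (m : ℂ)
            + 2 * (Real.pi : ℂ) * Complex.I * (k : ℂ)
              / ((m : ℂ) * (Real.log (MonomialIntegral.resCard K) : ℂ)) := by
  have : Nonempty (Fin l) := ⟨⟨0, hl⟩⟩
  have hq : (resCard K : ℂ) ≠ 0 := by exact_mod_cast (one_lt_resCard.trans' zero_lt_one).ne'
  obtain ⟨P, D, hD, hP⟩ := exists_polynomial_sum_tsum_minCell (norm_inv_resCard_lt_one K)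
    ((1 - (resCard K : ℂ)⁻¹) ^ n) N (fun i => (ord (c i : K)).toNat) e₀ v
  refine ⟨algebraMap _ _ P / algebraMap _ _ D, fun s hs => ?_,
    meromorphic_ratFunc_eval_cpow_neg hq _, fun s hs => ?_⟩
  · have hT := norm_resCard_cpow_neg_le_one K hs.le
    have hDT : D.eval ((resCard K : ℂ) ^ (-s)) ≠ 0 := fun h =>
      have ⟨i, _, ha, h1⟩ := hD _ h
      ne_of_apply_ne norm (by simpa using (norm_mpow_lt_one
        (norm_cellWeight_lt_one (norm_inv_resCard_lt_one K) hT v (N i)) ha.ne_zero).ne) h1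
    obtain ⟨hint, hval⟩ := integral_polydisc_eq_sum_tsum μ hμ (N := N) (v := v) (e := e₀) hc hs.le
    exact ⟨hint, by rw [eval_ratFunc_div hDT, eq_div_iff hDT, hval, hP _ hT]⟩
  · obtain ⟨i, a, ha, h1⟩ := hD _ (eval_eq_zero_of_isPole hq hs)
    obtain ⟨hm, k, hk⟩ := ha.eq_of_mpow_cellWeight_eq_one one_lt_resCard h1
    refine ⟨_, a, (N i ⬝ᵥ a : ℕ), k, ha.isFacet_minFace, isPrimitiveNormal_minFace ha.gcd_eq_one,
      ha.supportMin_eq.symm, ?_, Nat.cast_ne_zero.2 hm, hk⟩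
    rw [minFace, ha.supportMin_eq, dotProduct]
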